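/- Let $d\ge 3$ and let $x\cdot y=-x^0y^0+\sum_{a=1}^{d+1}x^ay^a$ on $\mathbb C^{d+2}$. For vectors $P_1,P_2,P_3,Z_1,Z_2,Z_3\in\mathbb C^{d+2}$ put $P_{jk}=P_j\cdot P_k$, $$H_{jk}=-2\big[(Z_j\cdot Z_k)(P_j\cdot P_k)-(Z_j\cdot P_k)(Z_k\cdot P_j)\big],\qquad V_{j,kl}=\frac{(Z_j\cdot P_k)(P_j\cdot P_l)-(Z_j\cdot P_l)(P_j\cdot P_k)}{P_k\cdot P_l}.$$ Let $f$ be the map that replaces the formal variables $P_{jk},H_{jk},V_{j,kl}$ by these functions, where complex powers of the $P_{jk}$ are formed with any holomorphic branch of the logarithm. Equalities between functions are understood on the locus $P_j\cdot P_j=P_j\cdot Z_j=Z_j\cdot Z_j=0$ $(j=1,2,3)$, where the $P_{jk}$, $j\neq k$, are non-zero and lie in the domain of the branch; derivatives are taken before restricting to it. For $\mathbf s\in\mathbb Z_{\ge0}^3$ and $\mathbf\Delta\in\mathbb C^3$ put $\tau_{ij,k}=\frac12(s_i+s_j-s_k+\Delta_i+\Delta_j-\Delta_k)$. Let $$D_Z=\Big(\frac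 d2-1+Z\cdot\frac{\partial}{\partial Z}\Big)\frac{\partial}{\partial Z}-\frac12 Z\,\frac{\partial^2}{\partial Z\cdot\partial Z}$$ be the Thomas–Todorov operator. A differential operator on $\mathbb C[H_{jk},V_{j,kl}]$, the polynomial ring in the six variables $H_{12},H_{23},H_{13},V_{1,23},V_{2,31},V_{3,12}$, means an element of the Weyl algebra (finite order, polynomial coefficients). Fix $i\in\{1,2,3\}$. For $\mathbf s$ with $s_i\ge1$, put $t_i=s_i-1$, and say that a differential operator $\mathcal D$ reproduces $\partial_{P_i}\cdot D_{Z_i}$ for $(\mathbf s,\mathbf\Delta)$ if $$(\partial_{P_i}\cdot D_{Z_i})\, f\!\left(\frac{H_{12}^{h_1}H_{23}^{h_2}H_{13}^{h_3}V_{1,23}^{v_1}V_{2,31}^{v_2}V_{3,12}^{v_3}}{P_{12}^{\tau_{12,3}}P_{23}^{\tau_{23,1}}P_{13}^{\tau_{31,2}}}\right)=f\!\left(\frac{\mathcal D\big(H_{12}^{h_1}H_{23}^{h_2}H_{13}^{h_3}V_{1,23}^{v_1}V_{2,31}^{v_2}V_{3,12}^{v_3}\big)}{P_{12}^{\tau_{12,3}}P_{23}^{\tau_{23,1}}P_{13}^{\tau_{31,2}}}\right)$$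 for all $h_1,h_2,h_3,v_1,v_2,v_3\in\mathbb Z_{\ge0}$ with $v_1+h_1+h_3=s_1$, $v_2+h_1+h_2=s_2$, $v_3+h_2+h_3=s_3$. 1. (Fixed spins.) For every $\mathbf s\in\mathbb Z_{\ge0}^3$ with $s_i\ge2$ and every $\mathbf\Delta\in\mathbb C^3$, there is a differential operator $\mathcal D_{i,1}$ that reproduces $\partial_{P_i}\cdot D_{Z_i}$ for $(\mathbf s,\mathbf\Delta)$ if and only if $\Delta_i=d-1+t_i$. 2. (All spins at once, including $s_i=1$.) Fix $\Delta_j\in\mathbb C$ for $j\ne i$, and let the dimension of the $i$th point be given as a function of its spin, $\Delta_i=\delta(s_i)$ with $\delta:\mathbb Z_{\ge1}\to\mathbb C$. There is a single differential operator $\mathcal D_{i,1}$, not depending on $\mathbf s$, that reproduces $\partial_{P_i}\cdot D_{Z_i}$ for $(\mathbf s,\mathbf\Delta)$ for all $\mathbf s\in\mathbb Z_{\ge0}^3$ with $s_i\ge1$, if and only if $\Delta_i=d-1+t_i$ for every value $s_i\ge 1$. -/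

import Mathlib

open scoped BigOperators

namespace ThreePoint

noncomputable section

/-- Complexified embedding space `ℂ^{1,d+1}`; the coordinate `0` is the time coordinate. -/
abbrev Vec (d : ℕ) : Type := Fin (d + 2) → ℂ

/-- Diagonal entries of the Lorentzian metric `diag(-1, 1, …, 1)`. -/
def eta {d : ℕ} (a : Fin (d + 2)) : ℂ := if a = 0 then -1 else 1

/-- The (bilinear) Lorentzian scalar product. -/
def dot {d : ℕ} (x y : Vec d) : ℂ := ∑ a, eta a * x a * y a

/-- A triple of vectors, `(P₁, P₂, P₃)` or `(Z₁, Z₂, Z₃)`. Labels are taken in `Fin 3`, so that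
`j`, `j + 1`, `j + 2` run cyclically through the three labels. -/
abbrev Triple (d : ℕ) : Type := Fin 3 → Vec d

/-- Functions of the positions `P` and the polarisations `Z`. -/
abbrev Fn (d : ℕ) : Type := Triple d → Triple d → ℂ

/-- The partial derivative `∂/∂P_i^a`. -/
def dP {d : ℕ} (i : Fin 3) (a : Fin (d + 2)) (F : Fn d) : Fn d := fun P Z =>
  lineDeriv ℂ (fun P' : Triple d => F P' Z) P (Pi.single i (Pi.single a 1))

/-- The partial derivative `∂/∂Z_i^a`. -/
def dZ {d : ℕ} (i : Fin 3) (a : Fin (d + 2)) (F : Fn d) : Fn d := fun P Z =>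
  lineDeriv ℂ (fun Z' : Triple d => F P Z') Z (Pi.single i (Pi.single a 1))

/-- The component with lower index `a` of the Thomas–Todorov operator
`D_Z = (d/2 - 1 + Z·∂/∂Z) ∂/∂Z - (1/2) Z ∂²/(∂Z·∂Z)` in the variable `Z = Z_i`. -/
def thomasTodorov {d : ℕ} (i : Fin 3) (a : Fin (d + 2)) (F : Fn d) : Fn d := fun P Z =>
  ((d : ℂ) / 2 - 1) * dZ i a F P Z + ∑ b, Z i b * dZ i b (dZ i a F) P Z
    - 1 / 2 * (eta a * Z i a) * ∑ b, eta b * dZ i b (dZ i b F) P Z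

/-- The operator `∂_{P_i} · D_{Z_i}`. -/
def divergence {d : ℕ} (i : Fin 3) (F : Fn d) : Fn d := fun P Z =>
  ∑ a, eta a * dP i a (thomasTodorov i a F) P Z

/-- Labels of the formal building blocks: `Sum.inl j` stands for `H_{j,j+1}` (that is `H₁₂`, `H₂₃`,
`H₃₁ = H₁₃`), and `Sum.inr j` stands for `V_{j,(j+1)(j+2)}` (that is `V_{1,23}`, `V_{2,31}`,
`V_{3,12}`). -/
abbrev Block : Type := Fin 3 ⊕ Fin 3

/-- The embedding-space structure of a building block. -/
def blockValue {d : ℕ} (P Z : Triple d) : Block → ℂ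
  | Sum.inl j => -2 * (dot (Z j) (Z (j + 1)) * dot (P j) (P (j + 1))
      - dot (Z j) (P (j + 1)) * dot (Z (j + 1)) (P j))
  | Sum.inr j => (dot (Z j) (P (j + 1)) * dot (P j) (P (j + 2))
      - dot (Z j) (P (j + 2)) * dot (P j) (P (j + 1))) / dot (P (j + 1)) (P (j + 2))

/-- The monomial with exponents `h j` of `H_{j,j+1}` and `v j` of `V_{j,(j+1)(j+2)}`. -/
def blockMonomial (h v : Fin 3 → ℕ) : MvPolynomial Block ℂ :=
  ∏ j, (MvPolynomial.X (Sum.inl j) ^ h j * MvPolynomial.X (Sum.inr j) ^ v j)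

/-- `tau s Δ j` is `τ_{j(j+1),j+2}`, the exponent of `P_{j,j+1}`. -/
def tau (s : Fin 3 → ℕ) (Δ : Fin 3 → ℂ) (j : Fin 3) : ℂ :=
  ((s j : ℂ) + s (j + 1) - s (j + 2) + Δ j + Δ (j + 1) - Δ (j + 2)) / 2

/-- `L` is a holomorphic branch of the logarithm on the open set `U`. -/
def IsLogBranch (L : ℂ → ℂ) (U : Set ℂ) : Prop :=
  IsOpen U ∧ DifferentiableOn ℂ L U ∧ ∀ z ∈ U, Complex.exp (L z) = z

/-- The function `f(q / (P₁₂^{τ_{12,3}} P₂₃^{τ_{23,1}} P₃₁^{τ_{31,2}}))`, for a polynomial `q` in the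
`H`s and `V`s, where complex powers are formed with `L`: `z ^ τ = exp (τ L(z))`. -/
def evalOverPrefactor {d : ℕ} (L : ℂ → ℂ) (s : Fin 3 → ℕ) (Δ : Fin 3 → ℂ)
    (q : MvPolynomial Block ℂ) : Fn d := fun P Z =>
  MvPolynomial.aeval (blockValue P Z) q /
    ∏ j, Complex.exp (tau s Δ j * L (dot (P j) (P (j + 1))))

/-- The locus `P_j² = P_j·Z_j = Z_j² = 0` for `j = 1, 2, 3`. -/
def OnLocus {d : ℕ} (P Z : Triple d) : Prop :=
  ∀ j, dot (P j) (P j) = 0 ∧ dot (P j) (Z j) = 0 ∧ dot (Z j) (Z j) = 0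

/-- The algebra of differential operators with polynomial coefficients (Weyl algebra) acting on
`ℂ[H_{ij}, V_{i,jk}]`: it is generated by the multiplications by, and the partial derivatives with
respect to, the variables. -/
def diffOps : Subalgebra ℂ (Module.End ℂ (MvPolynomial Block ℂ)) :=
  Algebra.adjoin ℂ
    (Set.range (fun b : Block => LinearMap.mulLeft ℂ (MvPolynomial.X b : MvPolynomial Block ℂ)) ∪
      Set.range (fun b : Block =>
        ((MvPolynomial.pderiv b : Derivation ℂ (MvPolynomial Block ℂ) (MvPolynomial Block ℂ)) :
          MvPolynomial Block ℂ →ₗ[ℂ] MvPolynomial Block ℂ)))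

/-- On all monomials of spins `s`, divided by the prefactor for `(s, Δ)`, the operator
`∂_{P_i} · D_{Z_i}` acts as the operator `D` on the numerator. The equality is one of functions on
the locus `P_j² = P_j·Z_j = Z_j² = 0`, wherever the `P_{jk}` are in the domain of a branch of the
logarithm that defines their powers. -/
def Reproduces (d : ℕ) (i : Fin 3) (s : Fin 3 → ℕ) (Δ : Fin 3 → ℂ)
    (D : Module.End ℂ (MvPolynomial Block ℂ)) : Prop :=
  ∀ h v : Fin 3 → ℕ, (∀ j, v j + h j + h (j + 2) = s j) →
    ∀ (L : ℂ → ℂ) (U : Set ℂ), IsLogBranch L U →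
      ∀ P Z : Triple d, OnLocus P Z → (∀ j, dot (P j) (P (j + 1)) ∈ U) →
        divergence i (evalOverPrefactor L s Δ (blockMonomial h v)) P Z
          = evalOverPrefactor L s Δ (D (blockMonomial h v)) P Z

end

end ThreePoint

/-! Write `P, Z` for `P_i, Z_i`, `A, B` for `P_{i+1}, P_{i+2}`, and put `κ = (P·A)(P·B)/(A·B)`, `w_A
= (Z·A)(P·B)/(A·B)`, `w_B = (Z·B)(P·A)/(A·B)`, so that `V_i = w_A - w_B`. By the chain rule,
`∂_P·D_Z` becomes a sum of scalar products of gradients of the blocks. All of them are expressible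
in the blocks except for the combination `w_A + w_B`. The outcome, `divergence_evalOverPrefactor`,
is that `∂_P·D_Z` acts on the numerator as an explicit differential operator plus `(d - 2 + s_i -
Δ_i)/2 · (w_A + w_B)` times the block form of the Laplacian in `Z_i`; here `τ_i + τ_{i+2} = s_i +
Δ_i` has been used.

At `Δ_i = d - 2 + s_i = d - 1 + t_i` the obstruction disappears. The remaining numerical
coefficients are affine in the spins, so Euler operators can replace them, and one operator serves
all spins (`exists_reproduces`).

Conversely, `Z_i ↦ Z_i + t P_i` preserves the locus and all blocks but moves `w_A + w_B` by `2tκ`. A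
reproduced function cannot change, so the coefficient vanishes as soon as the Laplacian is non-zero
somewhere, which a monomial in the `V`s achieves for `s_i ≥ 2` (`dimension_eq_of_reproduces`).

For `s_i = 1` the Laplacian vanishes identically, and only uniformity in the spin constrains `Δ_i`.
Commutators with a variable are nilpotent on the Weyl algebra, so the values of `D` on `H_{i,i+1}
V_i^k`, at a point with `V_i = 1`, are polynomial in `k`. The cases `k ≥ 1` thus determine the case
`k = 0`, whose value involves `δ(1)` (`dimension_one_eq_of_reproduces`). -/

namespace ThreePoint

noncomputable section

open MvPolynomial

/-! ### Bilinearity of the scalar product. -/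

section Dot

variable {d : ℕ}

theorem eta_mul_eta (a : Fin (d + 2)) : eta a * eta a = 1 := by
  unfold eta; split_ifs <;> norm_num

theorem dot_comm (x y : Vec d) : dot x y = dot y x :=
  Finset.sum_congr rfl fun a _ => by ring

theorem dot_add_left (x y z : Vec d) : dot (x + y) z = dot x z + dot y z := by
  simp only [dot, ← Finset.sum_add_distrib, Pi.add_apply]
  exact Finset.sum_congr rfl fun a _ => by ring

theorem dot_smul_left (c : ℂ) (x y : Vec d) : dot (c • x) y = c * dot x y := by
  simp only [dot, Finset.mul_sum, Pi.smul_apply, smul_eq_mul]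
  exact Finset.sum_congr rfl fun a _ => by ring

theorem dot_add_right (x y z : Vec d) : dot x (y + z) = dot x y + dot x z := by
  rw [dot_comm, dot_add_left, dot_comm y, dot_comm z]

theorem dot_smul_right (c : ℂ) (x y : Vec d) : dot x (c • y) = c * dot x y := by
  rw [dot_comm, dot_smul_left, dot_comm y]

theorem dot_zero_left (x : Vec d) : dot 0 x = 0 := by simp [dot]

theorem dot_zero_right (x : Vec d) : dot x 0 = 0 := by simp [dot]

theorem dot_neg_left (x y : Vec d) : dot (-x) y = -dot x y := by
  rw [← neg_one_smul ℂ x, dot_smul_left, neg_one_mul]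

theorem dot_neg_right (x y : Vec d) : dot x (-y) = -dot x y := by
  rw [dot_comm, dot_neg_left, dot_comm]

theorem dot_sub_left (x y z : Vec d) : dot (x - y) z = dot x z - dot y z := by
  rw [sub_eq_add_neg, dot_add_left, dot_neg_left, sub_eq_add_neg]

theorem dot_sub_right (x y z : Vec d) : dot x (y - z) = dot x y - dot x z := by
  rw [sub_eq_add_neg, dot_add_right, dot_neg_right, sub_eq_add_neg]

theorem dot_sum_right {ι : Type*} (s : Finset ι) (x : Vec d) (y : ι → Vec d) :
    dot x (∑ k ∈ s, y k) = ∑ k ∈ s, dot x (y k) := by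
  classical
  induction s using Finset.induction_on with
  | empty => simp [dot_zero_right]
  | insert k s hk ih => rw [Finset.sum_insert hk, Finset.sum_insert hk, dot_add_right, ih]

theorem dot_single_left (a : Fin (d + 2)) (x : Vec d) :
    dot (Pi.single a 1) x = eta a * x a := by
  simp only [dot]
  rw [Finset.sum_eq_single a]
  · simp
  · intro b _ hb
    simp [Pi.single_eq_of_ne hb]
  · simp

theorem sum_dot_single_mul (x y : Vec d) :
    ∑ a, dot (Pi.single a 1) x * y a = dot y x := by
  simp only [dot_single_left]
  exact Finset.sum_congr rfl fun a _ => by ring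

end Dot

/-! ### Scalar products of the gradients of the blocks. -/

section Gradients

variable {d : ℕ}

/-- The gradient of `V_{i,jk}` with respect to `Z_i`. -/
def gradZV (P A B : Vec d) : Vec d := (dot P B / dot A B) • A - (dot P A / dot A B) • B

/-- The gradient of `H_{ij}` with respect to `Z_i`. -/
def gradZH (P A α : Vec d) : Vec d := (-2 * dot P A) • α + (2 * dot P α) • A

/-- The structure `V_{i,jk}` in terms of the vectors it depends on. -/
def structV (P Z A B : Vec d) : ℂ := (dot Z A * dot P B - dot Z B * dot P A) / dot A B

/-- The structure `H_{ij}` in terms of the vectors it depends on. -/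
def structH (P Z A α : Vec d) : ℂ := -2 * (dot Z α * dot P A - dot Z A * dot P α)

/-- The gradient of `V_{i,jk}` with respect to `P_i`. -/
def gradPV (Z A B : Vec d) : Vec d := (dot Z A / dot A B) • B - (dot Z B / dot A B) • A

/-- The gradient of `H_{ij}` with respect to `P_i`. -/
def gradPH (Z A α : Vec d) : Vec d := (-2 * dot Z α) • A + (2 * dot Z A) • α

/-- The gradient of `V_{j,ki}` with respect to `P_i`. -/
def gradPVnext (P A B α : Vec d) : Vec d :=
  (dot α B / dot P B) • A - (dot A B / dot P B) • α - (structV A α B P / dot P B) • B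

/-- The gradient of `V_{k,ij}` with respect to `P_i`. -/
def gradPVprev (P A B β : Vec d) : Vec d :=
  (dot A B / dot P A) • β - (dot β A / dot P A) • B - (structV B β P A / dot P A) • A

variable {P Z A B α β : Vec d}

/-- The products of two `Z_i`-gradients share the factor `κ = (P·A)(P·B)/(A·B)`, with coefficients
polynomial in the blocks that do not contain `Z_i`. Only the null conditions at the other two points
enter, none on `P`; this is what permits a later differentiation in `P`. -/
theorem dot_gradZV_self (hA : dot A A = 0) (hB : dot B B = 0) (hAB : dot A B ≠ 0) :
    dot (gradZV P A B) (gradZV P A B) = -2 * (dot P A * dot P B / dot A B) := by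
  simp only [gradZV, dot_sub_left, dot_sub_right, dot_smul_left, dot_smul_right, hA, hB,
    dot_comm B A]
  field_simp
  ring

theorem dot_gradZH_self (hA : dot A A = 0) (hAα : dot A α = 0) (hα : dot α α = 0) :
    dot (gradZH P A α) (gradZH P A α) = 0 := by
  simp only [gradZH, dot_add_left, dot_add_right, dot_smul_left, dot_smul_right, hA, hα, hAα,
    dot_comm α A]
  ring

theorem dot_gradZV_gradZH (hA : dot A A = 0) (hAα : dot A α = 0)
    (hAB : dot A B ≠ 0) (hPB : dot P B ≠ 0) :
    dot (gradZV P A B) (gradZH P A α) =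
      2 * (dot P A * dot P B / dot A B) * structV A α B P := by
  simp only [gradZV, gradZH, structV, dot_sub_left, dot_add_right, dot_smul_left, dot_smul_right,
    hA, hAα, dot_comm B A, dot_comm α P, dot_comm B P, dot_comm A P, dot_comm α B]
  field_simp
  ring

theorem dot_gradZV_gradZH' (hB : dot B B = 0) (hBβ : dot B β = 0)
    (hAB : dot A B ≠ 0) (hPA : dot P A ≠ 0) :
    dot (gradZV P A B) (gradZH P B β) =
      2 * (dot P A * dot P B / dot A B) * structV B β P A := by
  simp only [gradZV, gradZH, structV, dot_sub_left, dot_add_right, dot_smul_left, dot_smul_right,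
    hB, hBβ, dot_comm B A, dot_comm β P, dot_comm B P, dot_comm β A]
  field_simp
  ring

theorem dot_gradZH_gradZH (hAB : dot A B ≠ 0) (hPA : dot P A ≠ 0) (hPB : dot P B ≠ 0) :
    dot (gradZH P A α) (gradZH P B β) =
      -2 * (dot P A * dot P B / dot A B) *
        (structH A α B β + 2 * structV A α B P * structV B β P A) := by
  simp only [gradZH, structV, structH, dot_add_left, dot_add_right, dot_smul_left, dot_smul_right,
    dot_comm B A, dot_comm β P, dot_comm B P, dot_comm A P, dot_comm β A, dot_comm α P]
  field_simp
  ring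

theorem dot_self_gradZV : dot Z (gradZV P A B) = structV P Z A B := by
  simp only [gradZV, structV, dot_sub_right, dot_smul_right]
  ring

theorem dot_self_gradZH : dot Z (gradZH P A α) = structH P Z A α := by
  simp only [gradZH, structH, dot_add_right, dot_smul_right]
  ring

theorem gradZV_dot_left (hA : dot A A = 0) (hAB : dot A B ≠ 0) :
    dot (gradZV P A B) A = -dot P A := by
  simp only [gradZV, dot_sub_left, dot_smul_left, hA, dot_comm B A]
  field_simp
  ring

theorem gradZV_dot_right (hB : dot B B = 0) (hAB : dot A B ≠ 0) :
    dot (gradZV P A B) B = dot P B := by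
  simp only [gradZV, dot_sub_left, dot_smul_left, hB]
  field_simp
  ring

theorem gradZH_dot_self (hA : dot A A = 0) (hAα : dot A α = 0) :
    dot (gradZH P A α) A = 0 := by
  simp only [gradZH, dot_add_left, dot_smul_left, hA, dot_comm α A, hAα]
  ring

theorem gradZH_dot_right (hPB : dot P B ≠ 0) :
    dot (gradZH P A α) B = -2 * dot P B * structV A α B P := by
  simp only [gradZH, structV, dot_add_left, dot_smul_left, dot_comm α P, dot_comm A P,
    dot_comm B P]
  field_simp
  ring

theorem gradZH_dot_left (hPA : dot P A ≠ 0) :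
    dot (gradZH P B β) A = 2 * dot P A * structV B β P A := by
  simp only [gradZH, structV, dot_add_left, dot_smul_left, dot_comm β P, dot_comm B A,
    dot_comm B P]
  field_simp
  ring

/-- The products of a `Z_i`-gradient with a `P_i`-gradient contain `w_A = (Z·A)(P·B)/(A·B)` and `w_B
= (Z·B)(P·A)/(A·B)` separately, and so need not be functions of the blocks. -/
theorem dot_gradZV_gradPV (hA : dot A A = 0) (hB : dot B B = 0) (hAB : dot A B ≠ 0) :
    dot (gradZV P A B) (gradPV Z A B) =
      dot Z A * dot P B / dot A B + dot Z B * dot P A / dot A B := by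
  simp only [gradPV, dot_sub_right, dot_smul_right, gradZV_dot_left hA hAB,
    gradZV_dot_right hB hAB]
  ring

theorem dot_gradZH_gradPV (hA : dot A A = 0) (hAα : dot A α = 0) (hPB : dot P B ≠ 0) :
    dot (gradZH P A α) (gradPV Z A B) =
      -2 * structV A α B P * (dot Z A * dot P B / dot A B) := by
  simp only [gradPV, dot_sub_right, dot_smul_right, gradZH_dot_self hA hAα,
    gradZH_dot_right hPB]
  ring

theorem dot_gradZH_gradPV' (hB : dot B B = 0) (hBβ : dot B β = 0) (hPA : dot P A ≠ 0) :
    dot (gradZH P B β) (gradPV Z A B) =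
      -2 * structV B β P A * (dot Z B * dot P A / dot A B) := by
  simp only [gradPV, dot_sub_right, dot_smul_right, gradZH_dot_self hB hBβ,
    gradZH_dot_left hPA]
  ring

theorem dot_gradZV_gradPH (hA : dot A A = 0) (hAα : dot A α = 0) (hAB : dot A B ≠ 0)
    (hPB : dot P B ≠ 0) :
    dot (gradZV P A B) (gradPH Z A α) = -structH P Z A α
      - 2 * (dot Z A * dot P B / dot A B) * structV A α B P := by
  simp only [gradZV, gradPH, structV, structH, dot_sub_left, dot_add_right, dot_smul_left,
    dot_smul_right, hA, hAα, dot_comm B A, dot_comm α P, dot_comm B P, dot_comm A P, dot_comm α B]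
  field_simp
  ring

theorem dot_gradZV_gradPH' (hB : dot B B = 0) (hBβ : dot B β = 0) (hAB : dot A B ≠ 0)
    (hPA : dot P A ≠ 0) :
    dot (gradZV P A B) (gradPH Z B β) = structH P Z B β
      - 2 * (dot Z B * dot P A / dot A B) * structV B β P A := by
  simp only [gradZV, gradPH, structV, structH, dot_sub_left, dot_add_right, dot_smul_left,
    dot_smul_right, hB, hBβ, dot_comm B A, dot_comm β P, dot_comm B P, dot_comm β A]
  field_simp
  ring

theorem dot_gradZH_gradPH_self (hA : dot A A = 0) (hAα : dot A α = 0) (hα : dot α α = 0) :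
    dot (gradZH P A α) (gradPH Z A α) = 0 := by
  simp only [gradZH, gradPH, dot_add_left, dot_add_right, dot_smul_left, dot_smul_right, hA, hα,
    hAα, dot_comm α A]
  ring

theorem dot_gradZH_gradPH (hAB : dot A B ≠ 0) (hPA : dot P A ≠ 0) (hPB : dot P B ≠ 0) :
    dot (gradZH P A α) (gradPH Z B β) = -2 * structV A α B P * structH P Z B β
      + 2 * (dot Z B * dot P A / dot A B) *
        (structH A α B β + 2 * structV A α B P * structV B β P A) := by
  simp only [gradZH, gradPH, structV, structH, dot_add_left, dot_add_right, dot_smul_left,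
    dot_smul_right, dot_comm B A, dot_comm β P, dot_comm B P, dot_comm A P, dot_comm β A,
    dot_comm α P]
  field_simp
  ring

theorem dot_gradZH_gradPH' (hAB : dot A B ≠ 0) (hPA : dot P A ≠ 0) (hPB : dot P B ≠ 0) :
    dot (gradZH P B β) (gradPH Z A α) = 2 * structV B β P A * structH P Z A α
      + 2 * (dot Z A * dot P B / dot A B) *
        (structH A α B β + 2 * structV A α B P * structV B β P A) := by
  simp only [gradZH, gradPH, structV, structH, dot_add_left, dot_add_right, dot_smul_left,
    dot_smul_right, dot_comm B A, dot_comm β P, dot_comm B P, dot_comm A P, dot_comm β A,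
    dot_comm α P, dot_comm β α, dot_comm B α]
  field_simp
  ring

theorem dot_gradZV_gradPVnext (hA : dot A A = 0) (hB : dot B B = 0) (hAα : dot A α = 0)
    (hAB : dot A B ≠ 0) (hPB : dot P B ≠ 0) :
    dot (gradZV P A B) (gradPVnext P A B α) = -structV A α B P := by
  simp only [gradPVnext, dot_sub_right, dot_smul_right, gradZV_dot_left hA hAB,
    gradZV_dot_right hB hAB]
  simp only [gradZV, dot_sub_left, dot_smul_left, hAα, dot_comm α B]
  field_simp
  ring

theorem dot_gradZV_gradPVprev (hA : dot A A = 0) (hB : dot B B = 0) (hBβ : dot B β = 0)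
    (hAB : dot A B ≠ 0) (hPA : dot P A ≠ 0) :
    dot (gradZV P A B) (gradPVprev P A B β) = structV B β P A := by
  simp only [gradPVprev, dot_sub_right, dot_smul_right, gradZV_dot_left hA hAB,
    gradZV_dot_right hB hAB]
  simp only [gradZV, dot_sub_left, dot_smul_left, hBβ, dot_comm β A]
  field_simp
  ring

theorem dot_gradZH_gradPVnext (hA : dot A A = 0) (hAα : dot A α = 0) (hα : dot α α = 0)
    (hPB : dot P B ≠ 0) :
    dot (gradZH P A α) (gradPVnext P A B α) = 2 * structV A α B P ^ 2 := by
  simp only [gradPVnext, dot_sub_right, dot_smul_right, gradZH_dot_self hA hAα,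
    gradZH_dot_right hPB]
  simp only [gradZH, dot_add_left, dot_smul_left, hAα, hα]
  field_simp
  ring

theorem dot_gradZH_gradPVprev' (hB : dot B B = 0) (hBβ : dot B β = 0) (hβ : dot β β = 0)
    (hPA : dot P A ≠ 0) :
    dot (gradZH P B β) (gradPVprev P A B β) = -2 * structV B β P A ^ 2 := by
  simp only [gradPVprev, dot_sub_right, dot_smul_right, gradZH_dot_self hB hBβ,
    gradZH_dot_left hPA]
  simp only [gradZH, dot_add_left, dot_smul_left, hBβ, hβ]
  field_simp
  ring

theorem dot_gradZH_gradPVprev (hA : dot A A = 0) (hAα : dot A α = 0) (hPA : dot P A ≠ 0)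
    (hPB : dot P B ≠ 0) :
    dot (gradZH P A α) (gradPVprev P A B β) = structH A α B β := by
  simp only [gradPVprev, dot_sub_right, dot_smul_right, gradZH_dot_self hA hAα,
    gradZH_dot_right hPB]
  simp only [gradZH, structV, structH, dot_add_left, dot_smul_left, dot_comm A P, dot_comm α P,
    dot_comm B P, dot_comm β A]
  field_simp
  ring

theorem dot_gradZH_gradPVnext' (hB : dot B B = 0) (hBβ : dot B β = 0) (hPA : dot P A ≠ 0)
    (hPB : dot P B ≠ 0) :
    dot (gradZH P B β) (gradPVnext P A B α) = -structH A α B β := by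
  simp only [gradPVnext, dot_sub_right, dot_smul_right, gradZH_dot_self hB hBβ,
    gradZH_dot_left hPA]
  simp only [gradZH, structV, structH, dot_add_left, dot_smul_left, dot_comm B P, dot_comm β P,
    dot_comm α B, dot_comm B A, dot_comm β α, dot_comm β A]
  field_simp
  ring

theorem dot_self_gradPV : dot Z (gradPV Z A B) = 0 := by
  simp only [gradPV, dot_sub_right, dot_smul_right]
  ring

theorem dot_self_gradPH : dot Z (gradPH Z A α) = 0 := by
  simp only [gradPH, dot_add_right, dot_smul_right]
  ring

/-- The factor `κ` that accompanies the Laplacian is what makes this contraction a polynomial in the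
blocks. -/
theorem dot_self_gradPVnext (hAB : dot A B ≠ 0) (hPB : dot P B ≠ 0) :
    dot P A * dot P B / dot A B * dot Z (gradPVnext P A B α) =
      structH P Z A α / 2 + structV P Z A B * structV A α B P := by
  simp only [gradPVnext, structV, structH, dot_sub_right, dot_smul_right, dot_comm A P,
    dot_comm α P, dot_comm B P]
  field_simp
  ring

theorem dot_self_gradPVprev (hAB : dot A B ≠ 0) (hPA : dot P A ≠ 0) :
    dot P A * dot P B / dot A B * dot Z (gradPVprev P A B β) =
      -(structH P Z B β / 2) - structV P Z A B * structV B β P A := by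
  simp only [gradPVprev, structV, structH, dot_sub_right, dot_smul_right, dot_comm β P,
    dot_comm B P, dot_comm B A]
  field_simp
  ring

end Gradients

/-! ### Cyclic labels of the three points. -/

section Labels

/-- The triple with the vector `x` at label `i` and zero elsewhere. -/
abbrev slot {d : ℕ} (i : Fin 3) (x : Vec d) : Triple d := Pi.single i x

theorem label_add_one_add_one (i : Fin 3) : i + 1 + 1 = i + 2 := by revert i; decide
theorem label_add_one_add_two (i : Fin 3) : i + 1 + 2 = i := by revert i; decide
theorem label_add_two_add_one (i : Fin 3) : i + 2 + 1 = i := by revert i; decide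
theorem label_add_two_add_two (i : Fin 3) : i + 2 + 2 = i + 1 := by revert i; decide
theorem label_add_one_ne (i : Fin 3) : i + 1 ≠ i := by revert i; decide
theorem label_add_two_ne (i : Fin 3) : i + 2 ≠ i := by revert i; decide
theorem label_add_two_ne_add_one (i : Fin 3) : i + 2 ≠ i + 1 := by revert i; decide
theorem label_cases (i j : Fin 3) : j = i ∨ j = i + 1 ∨ j = i + 2 := by revert i j; decide

theorem sum_labels {M : Type*} [AddCommMonoid M] (i : Fin 3) (f : Fin 3 → M) :
    ∑ j, f j = f i + f (i + 1) + f (i + 2) := by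
  have h : (Finset.univ : Finset (Fin 3)) = {i, i + 1, i + 2} := by revert i; decide
  rw [h, Finset.sum_insert, Finset.sum_insert, Finset.sum_singleton, add_assoc]
  · simp
  · simp

theorem prod_labels {M : Type*} [CommMonoid M] (i : Fin 3) (f : Fin 3 → M) :
    ∏ j, f j = f i * f (i + 1) * f (i + 2) :=
  sum_labels (M := Additive M) i f

theorem sum_blocks {M : Type*} [AddCommMonoid M] (i : Fin 3) (f : Block → M) :
    ∑ b, f b = f (Sum.inl i) + f (Sum.inl (i + 1)) + f (Sum.inl (i + 2)) +
      (f (Sum.inr i) + f (Sum.inr (i + 1)) + f (Sum.inr (i + 2))) := by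
  rw [Fintype.sum_sum_type, sum_labels i, sum_labels i]

variable {d : ℕ} (i : Fin 3) (X : Triple d) (x : Vec d) (t : ℂ)

theorem shift_self : (X + t • slot i x) i = X i + t • x := by simp

theorem shift_add_one : (X + t • slot i x) (i + 1) = X (i + 1) := by
  simp

theorem shift_add_two : (X + t • slot i x) (i + 2) = X (i + 2) := by
  simp

end Labels

/-! ### Directional derivatives of the blocks. -/

section BlockDerivatives

variable {d : ℕ} (i : Fin 3) (P Z : Triple d)

/-- The gradients of the building blocks with respect to `Z_i`. -/
def gradZ : Block → Vec d
  | Sum.inl j => if j = i then gradZH (P i) (P (i + 1)) (Z (i + 1))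
      else if j = i + 1 then 0 else gradZH (P i) (P (i + 2)) (Z (i + 2))
  | Sum.inr j => if j = i then gradZV (P i) (P (i + 1)) (P (i + 2)) else 0

/-- The gradients of the building blocks with respect to `P_i`. -/
def gradP : Block → Vec d
  | Sum.inl j => if j = i then gradPH (Z i) (P (i + 1)) (Z (i + 1))
      else if j = i + 1 then 0 else gradPH (Z i) (P (i + 2)) (Z (i + 2))
  | Sum.inr j => if j = i then gradPV (Z i) (P (i + 1)) (P (i + 2))
      else if j = i + 1 then gradPVnext (P i) (P (i + 1)) (P (i + 2)) (Z (i + 1))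
      else gradPVprev (P i) (P (i + 1)) (P (i + 2)) (Z (i + 2))

@[simp] theorem gradZ_inl_self :
    gradZ i P Z (Sum.inl i) = gradZH (P i) (P (i + 1)) (Z (i + 1)) := by simp [gradZ]
@[simp] theorem gradZ_inl_add_one : gradZ i P Z (Sum.inl (i + 1)) = 0 := by simp [gradZ]
@[simp] theorem gradZ_inl_add_two :
    gradZ i P Z (Sum.inl (i + 2)) = gradZH (P i) (P (i + 2)) (Z (i + 2)) := by simp [gradZ]
@[simp] theorem gradZ_inr_self :
    gradZ i P Z (Sum.inr i) = gradZV (P i) (P (i + 1)) (P (i + 2)) := by simp [gradZ]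
@[simp] theorem gradZ_inr_add_one : gradZ i P Z (Sum.inr (i + 1)) = 0 := by simp [gradZ]
@[simp] theorem gradZ_inr_add_two : gradZ i P Z (Sum.inr (i + 2)) = 0 := by simp [gradZ]

@[simp] theorem gradP_inl_self :
    gradP i P Z (Sum.inl i) = gradPH (Z i) (P (i + 1)) (Z (i + 1)) := by simp [gradP]
@[simp] theorem gradP_inl_add_one : gradP i P Z (Sum.inl (i + 1)) = 0 := by simp [gradP]
@[simp] theorem gradP_inl_add_two :
    gradP i P Z (Sum.inl (i + 2)) = gradPH (Z i) (P (i + 2)) (Z (i + 2)) := by simp [gradP]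
@[simp] theorem gradP_inr_self :
    gradP i P Z (Sum.inr i) = gradPV (Z i) (P (i + 1)) (P (i + 2)) := by simp [gradP]
@[simp] theorem gradP_inr_add_one : gradP i P Z (Sum.inr (i + 1)) =
    gradPVnext (P i) (P (i + 1)) (P (i + 2)) (Z (i + 1)) := by simp [gradP]
@[simp] theorem gradP_inr_add_two : gradP i P Z (Sum.inr (i + 2)) =
    gradPVprev (P i) (P (i + 1)) (P (i + 2)) (Z (i + 2)) := by simp [gradP]

theorem blockValue_inl_self :
    blockValue P Z (Sum.inl i) = structH (P i) (Z i) (P (i + 1)) (Z (i + 1)) := by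
  simp only [blockValue, structH, dot_comm (Z (i + 1)) (P i)]

theorem blockValue_inl_add_one : blockValue P Z (Sum.inl (i + 1)) =
    structH (P (i + 1)) (Z (i + 1)) (P (i + 2)) (Z (i + 2)) := by
  rw [blockValue_inl_self, label_add_one_add_one]

theorem blockValue_inl_add_two : blockValue P Z (Sum.inl (i + 2)) =
    structH (P i) (Z i) (P (i + 2)) (Z (i + 2)) := by
  rw [blockValue_inl_self, label_add_two_add_one]
  simp only [structH, dot_comm (Z (i + 2)) (Z i), dot_comm (P (i + 2)) (P i),
    dot_comm (P (i + 2)) (Z i), dot_comm (P i) (Z (i + 2))]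
  ring

theorem blockValue_inr_self :
    blockValue P Z (Sum.inr i) = structV (P i) (Z i) (P (i + 1)) (P (i + 2)) := rfl

theorem blockValue_inr_add_one : blockValue P Z (Sum.inr (i + 1)) =
    structV (P (i + 1)) (Z (i + 1)) (P (i + 2)) (P i) := by
  rw [blockValue_inr_self, label_add_one_add_one, label_add_one_add_two]

theorem blockValue_inr_add_two : blockValue P Z (Sum.inr (i + 2)) =
    structV (P (i + 2)) (Z (i + 2)) (P i) (P (i + 1)) := by
  rw [blockValue_inr_self, label_add_two_add_one, label_add_two_add_two]

/-- Each block has degree at most one in `Z_i`. Hence second derivatives in `Z_i` produce only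
second derivatives of the polynomial. -/
theorem gradZ_shift (z : Vec d) (t : ℂ) :
    gradZ i P (Z + t • slot i z) = gradZ i P Z := by
  funext b
  rcases b with j | j <;> simp only [gradZ, shift_add_one, shift_add_two]

theorem blockValue_shiftZ (z : Vec d) (t : ℂ) (b : Block) :
    blockValue P (Z + t • slot i z) b = blockValue P Z b + t * dot z (gradZ i P Z b) := by
  rcases b with j | j <;> rcases label_cases i j with rfl | rfl | rfl
  · simp only [blockValue_inl_self, gradZ_inl_self, shift_self, shift_add_one, structH, gradZH,
      dot_add_left, dot_smul_left, dot_add_right, dot_smul_right]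
    ring
  · simp only [blockValue_inl_add_one, gradZ_inl_add_one, shift_add_one, shift_add_two,
      dot_zero_right, mul_zero, add_zero]
  · simp only [blockValue_inl_add_two, gradZ_inl_add_two, shift_self, shift_add_two, structH,
      gradZH, dot_add_left, dot_smul_left, dot_add_right, dot_smul_right]
    ring
  · simp only [blockValue_inr_self, gradZ_inr_self, shift_self, structV, gradZV,
      dot_add_left, dot_smul_left, dot_sub_right, dot_smul_right]
    ring
  · simp only [blockValue_inr_add_one, gradZ_inr_add_one, shift_add_one,
      dot_zero_right, mul_zero, add_zero]
  · simp only [blockValue_inr_add_two, gradZ_inr_add_two, shift_add_two,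
      dot_zero_right, mul_zero, add_zero]

theorem hasLineDerivAt_blockValue_Z (z : Vec d) (b : Block) :
    HasLineDerivAt ℂ (fun Z' => blockValue P Z' b) (dot z (gradZ i P Z b)) Z (slot i z) := by
  simp only [HasLineDerivAt, blockValue_shiftZ]
  simpa using ((hasDerivAt_id (0 : ℂ)).mul_const (dot z (gradZ i P Z b))).const_add
    (blockValue P Z b)

theorem hasDerivAt_dot_line (x y z : Vec d) :
    HasDerivAt (fun t : ℂ => dot (x + t • y) z) (dot y z) 0 := by
  simp only [dot_add_left, dot_smul_left]
  simpa using ((hasDerivAt_id (0 : ℂ)).mul_const (dot y z)).const_add (dot x z)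

variable {P}

theorem hasLineDerivAt_blockValue_P (x : Vec d) (hA : dot (P i) (P (i + 1)) ≠ 0)
    (hB : dot (P i) (P (i + 2)) ≠ 0) (b : Block) :
    HasLineDerivAt ℂ (fun P' => blockValue P' Z b) (dot x (gradP i P Z b)) P (slot i x) := by
  have hdot := hasDerivAt_dot_line (P i) x
  have hdot' : ∀ z, HasDerivAt (fun t : ℂ => dot z (P i + t • x)) (dot x z) 0 := fun z => by
    simpa only [dot_comm z] using hdot z
  have h0 : ∀ z : Vec d, dot (P i + (0 : ℂ) • x) z = dot (P i) z := by simp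
  have h0' : ∀ z : Vec d, dot z (P i + (0 : ℂ) • x) = dot (P i) z := by simp [dot_comm]
  rcases b with j | j <;> rcases label_cases i j with rfl | rfl | rfl
  · simp only [HasLineDerivAt, blockValue_inl_self, gradP_inl_self, shift_self, shift_add_one,
      structH]
    refine ((((hdot _).const_mul _).fun_sub ((hdot _).const_mul _)).const_mul _).congr_deriv ?_
    simp only [gradPH, dot_add_right, dot_smul_right]
    ring
  · simp only [HasLineDerivAt, blockValue_inl_add_one, gradP_inl_add_one, shift_add_one,
      shift_add_two, dot_zero_right]
    exact hasDerivAt_const _ _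
  · simp only [HasLineDerivAt, blockValue_inl_add_two, gradP_inl_add_two, shift_self,
      shift_add_two, structH]
    refine ((((hdot _).const_mul _).fun_sub ((hdot _).const_mul _)).const_mul _).congr_deriv ?_
    simp only [gradPH, dot_add_right, dot_smul_right]
    ring
  · simp only [HasLineDerivAt, blockValue_inr_self, gradP_inr_self, shift_self, shift_add_one,
      shift_add_two, structV]
    refine ((((hdot _).const_mul _).fun_sub ((hdot _).const_mul _)).div_const _).congr_deriv ?_
    simp only [gradPV, dot_sub_right, dot_smul_right]
    ring
  · simp only [HasLineDerivAt, blockValue_inr_add_one, gradP_inr_add_one, shift_self,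
      shift_add_one, shift_add_two, structV]
    refine ((((hdot' _).const_mul _).fun_sub ((hdot' _).mul_const _)).fun_div (hdot' _) ?_).congr_deriv
      ?_
    · simpa only [h0'] using hB
    · simp only [gradPVnext, structV, dot_sub_right, dot_smul_right, h0',
        dot_comm (P (i + 1)) (P i), dot_comm (P (i + 2)) (P i), dot_comm (Z (i + 1)) (P i)]
      field_simp
  · simp only [HasLineDerivAt, blockValue_inr_add_two, gradP_inr_add_two, shift_self,
      shift_add_one, shift_add_two, structV]
    refine ((((hdot' _).mul_const _).fun_sub ((hdot' _).const_mul _)).fun_div (hdot _) ?_).congr_deriv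
      ?_
    · simpa only [h0] using hA
    · simp only [gradPVprev, structV, dot_sub_right, dot_smul_right, h0', h0,
        dot_comm (P (i + 2)) (P i), dot_comm (Z (i + 2)) (P i),
        dot_comm (P (i + 2)) (P (i + 1))]
      field_simp

end BlockDerivatives

/-! ### Chain rule for polynomials and the derivative of a logarithm. -/

section ChainRule

theorem hasDerivAt_aeval {σ : Type*} [Fintype σ] {x : ℂ → σ → ℂ} {x' : σ → ℂ} {t : ℂ}
    (hx : ∀ b, HasDerivAt (fun t => x t b) (x' b) t) (q : MvPolynomial σ ℂ) :
    HasDerivAt (fun t => aeval (x t) q) (∑ b, aeval (x t) (pderiv b q) * x' b) t := by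
  induction q using MvPolynomial.induction_on with
  | C c => simpa using hasDerivAt_const t c
  | add p q hp hq =>
    simp only [map_add, add_mul, Finset.sum_add_distrib]
    exact hp.add hq
  | mul_X p b hp =>
    simp only [map_mul, aeval_X]
    refine (hp.mul (hx b)).congr_deriv ?_
    classical
    simp only [Derivation.leibniz, smul_eq_mul, map_add, map_mul, aeval_X, pderiv_X, add_mul,
      Finset.sum_add_distrib, Finset.sum_mul]
    rw [add_comm]
    congr 1
    · rw [Finset.sum_eq_single b]
      · simp
      · intro c _ hc
        simp [hc]
      · simp
    · exact Finset.sum_congr rfl fun c _ => by ring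

theorem IsLogBranch.hasDerivAt {L : ℂ → ℂ} {U : Set ℂ} (hL : IsLogBranch L U) {z : ℂ}
    (hz : z ∈ U) : HasDerivAt L z⁻¹ z := by
  obtain ⟨hU, hd, he⟩ := hL
  have h1 := (hd.differentiableAt (hU.mem_nhds hz)).hasDerivAt
  have h2 := h1.cexp
  have h3 : (fun w => Complex.exp (L w)) =ᶠ[nhds z] id :=
    Filter.eventually_of_mem (hU.mem_nhds hz) he
  have h4 := h2.unique ((hasDerivAt_id z).congr_of_eventuallyEq h3)
  rw [he z hz] at h4
  rwa [eq_inv_of_mul_eq_one_right h4] at h1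

theorem IsLogBranch.ne_zero {L : ℂ → ℂ} {U : Set ℂ} (hL : IsLogBranch L U) {z : ℂ}
    (hz : z ∈ U) : z ≠ 0 := by
  rw [← hL.2.2 z hz]
  exact Complex.exp_ne_zero _

end ChainRule

/-! ### First and second derivatives of a polynomial over the prefactor. -/

section Evaluation

variable {d : ℕ} (L : ℂ → ℂ) (s : Fin 3 → ℕ) (Δ : Fin 3 → ℂ) (P Z : Triple d)

@[simp] theorem evalOverPrefactor_zero : evalOverPrefactor L s Δ 0 P Z = 0 := by
  simp [evalOverPrefactor]

theorem evalOverPrefactor_add (q q' : MvPolynomial Block ℂ) :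
    evalOverPrefactor L s Δ (q + q') P Z =
      evalOverPrefactor L s Δ q P Z + evalOverPrefactor L s Δ q' P Z := by
  simp only [evalOverPrefactor, map_add, add_div]

theorem evalOverPrefactor_sub (q q' : MvPolynomial Block ℂ) :
    evalOverPrefactor L s Δ (q - q') P Z =
      evalOverPrefactor L s Δ q P Z - evalOverPrefactor L s Δ q' P Z := by
  simp only [evalOverPrefactor, map_sub, sub_div]

theorem evalOverPrefactor_mul (q q' : MvPolynomial Block ℂ) :
    evalOverPrefactor L s Δ (q * q') P Z =
      aeval (blockValue P Z) q * evalOverPrefactor L s Δ q' P Z := by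
  simp only [evalOverPrefactor, map_mul, mul_div_assoc]

theorem evalOverPrefactor_smul (c : ℂ) (q : MvPolynomial Block ℂ) :
    evalOverPrefactor L s Δ (c • q) P Z = c * evalOverPrefactor L s Δ q P Z := by
  simp only [evalOverPrefactor, map_smul, smul_eq_mul, mul_div_assoc]

theorem hasLineDerivAt_evalOverPrefactor_Z (i : Fin 3) (z : Vec d) (q : MvPolynomial Block ℂ) :
    HasLineDerivAt ℂ (fun Z' => evalOverPrefactor L s Δ q P Z')
      (∑ b, evalOverPrefactor L s Δ (pderiv b q) P Z * dot z (gradZ i P Z b)) Z (slot i z) := by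
  have h := (hasDerivAt_aeval (fun b => hasLineDerivAt_blockValue_Z i P Z z b) q).div_const
    (∏ j, Complex.exp (tau s Δ j * L (dot (P j) (P (j + 1)))))
  refine HasDerivAt.congr_deriv h ?_
  simp only [evalOverPrefactor, zero_smul, add_zero, Finset.sum_div]
  exact Finset.sum_congr rfl fun b _ => by ring

theorem dZ_sum_evalOverPrefactor {ι : Type*} [Fintype ι] (i : Fin 3) (a : Fin (d + 2))
    (q : ι → MvPolynomial Block ℂ) (g : Triple d → Triple d → ι → ℂ)
    (hg : ∀ (t : ℂ) (z : Vec d), g P (Z + t • slot i z) = g P Z) :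
    dZ i a (fun P Z => ∑ k, evalOverPrefactor L s Δ (q k) P Z * g P Z k) P Z =
      ∑ k, (∑ b, evalOverPrefactor L s Δ (pderiv b (q k)) P Z * (eta a * gradZ i P Z b a)) *
        g P Z k := by
  have h : HasLineDerivAt ℂ
      (fun Z' => ∑ k, evalOverPrefactor L s Δ (q k) P Z' * g P Z' k)
      (∑ k, (∑ b, evalOverPrefactor L s Δ (pderiv b (q k)) P Z *
        dot (Pi.single a 1) (gradZ i P Z b)) * g P Z k) Z (slot i (Pi.single a 1)) := by
    simp only [HasLineDerivAt, hg]
    exact HasDerivAt.fun_sum fun k _ =>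
      (hasLineDerivAt_evalOverPrefactor_Z L s Δ P Z i (Pi.single a 1) (q k)).mul_const _
  simp only [dot_single_left] at h
  exact h.lineDeriv

theorem dZ_evalOverPrefactor (i : Fin 3) (a : Fin (d + 2)) (q : MvPolynomial Block ℂ) :
    dZ i a (evalOverPrefactor L s Δ q) P Z =
      ∑ b, evalOverPrefactor L s Δ (pderiv b q) P Z * (eta a * gradZ i P Z b a) := by
  have h := (hasLineDerivAt_evalOverPrefactor_Z L s Δ P Z i (Pi.single a 1) q).lineDeriv
  simp only [dot_single_left] at h
  exact h

theorem dZ_dZ_evalOverPrefactor (i : Fin 3) (a c : Fin (d + 2)) (q : MvPolynomial Block ℂ) :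
    dZ i c (dZ i a (evalOverPrefactor L s Δ q)) P Z =
      ∑ b, (∑ b', evalOverPrefactor L s Δ (pderiv b' (pderiv b q)) P Z *
        (eta c * gradZ i P Z b' c)) * (eta a * gradZ i P Z b a) := by
  have h : dZ i a (evalOverPrefactor L s Δ q) = fun P Z =>
      ∑ b, evalOverPrefactor L s Δ (pderiv b q) P Z * (eta a * gradZ i P Z b a) := by
    funext P Z
    exact dZ_evalOverPrefactor L s Δ P Z i a q
  rw [h]
  refine dZ_sum_evalOverPrefactor L s Δ P Z i c (fun b => pderiv b q)
    (fun P Z b => eta a * gradZ i P Z b a) fun t z => ?_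
  funext b
  rw [gradZ_shift]

theorem thomasTodorov_evalOverPrefactor (i : Fin 3) (a : Fin (d + 2))
    (q : MvPolynomial Block ℂ) :
    thomasTodorov i a (evalOverPrefactor L s Δ q) P Z = eta a *
      (∑ b, (((d : ℂ) / 2 - 1) * evalOverPrefactor L s Δ (pderiv b q) P Z +
          ∑ b', evalOverPrefactor L s Δ (pderiv b' (pderiv b q)) P Z *
            dot (Z i) (gradZ i P Z b')) * gradZ i P Z b a -
        1 / 2 * (∑ b, ∑ b', evalOverPrefactor L s Δ (pderiv b' (pderiv b q)) P Z *
          dot (gradZ i P Z b') (gradZ i P Z b)) * Z i a) := by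
  simp only [thomasTodorov, dZ_evalOverPrefactor, dZ_dZ_evalOverPrefactor]
  have h1 : ∑ c, Z i c * ∑ b, (∑ b', evalOverPrefactor L s Δ (pderiv b' (pderiv b q)) P Z *
        (eta c * gradZ i P Z b' c)) * (eta a * gradZ i P Z b a) =
      ∑ b, (∑ b', evalOverPrefactor L s Δ (pderiv b' (pderiv b q)) P Z *
            dot (Z i) (gradZ i P Z b')) * (eta a * gradZ i P Z b a) := by
    simp only [dot, Finset.mul_sum, Finset.sum_mul]
    rw [Finset.sum_comm]
    refine Finset.sum_congr rfl fun b _ => ?_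
    rw [Finset.sum_comm]
    exact Finset.sum_congr rfl fun b' _ => Finset.sum_congr rfl fun c _ => by ring
  have h2 : ∑ c, eta c * ∑ b, (∑ b', evalOverPrefactor L s Δ (pderiv b' (pderiv b q)) P Z *
        (eta c * gradZ i P Z b' c)) * (eta c * gradZ i P Z b c) =
      ∑ b, ∑ b', evalOverPrefactor L s Δ (pderiv b' (pderiv b q)) P Z *
            dot (gradZ i P Z b') (gradZ i P Z b) := by
    simp only [dot, Finset.mul_sum, Finset.sum_mul]
    rw [Finset.sum_comm]
    refine Finset.sum_congr rfl fun b _ => ?_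
    rw [Finset.sum_comm]
    refine Finset.sum_congr rfl fun b' _ => Finset.sum_congr rfl fun c _ => ?_
    linear_combination (eta c * evalOverPrefactor L s Δ (pderiv b' (pderiv b q)) P Z *
      gradZ i P Z b' c * gradZ i P Z b c) * eta_mul_eta c
  rw [h1, h2]
  simp only [add_mul, Finset.sum_add_distrib, Finset.mul_sum, mul_sub, mul_add]
  congr 1
  · congr 1
    · exact Finset.sum_congr rfl fun b _ => by ring
    · exact Finset.sum_congr rfl fun b _ => by ring
  · simp only [Finset.sum_mul, Finset.mul_sum]
    exact Finset.sum_congr rfl fun b _ => Finset.sum_congr rfl fun b' _ => by ring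

/-- The gradient of `evalOverPrefactor L s Δ q` with respect to `P_i`. -/
def gradPEval (i : Fin 3) (q : MvPolynomial Block ℂ) : Vec d :=
  ∑ b, evalOverPrefactor L s Δ (pderiv b q) P Z • gradP i P Z b -
    evalOverPrefactor L s Δ q P Z •
      ((tau s Δ i / dot (P i) (P (i + 1))) • P (i + 1) +
        (tau s Δ (i + 2) / dot (P i) (P (i + 2))) • P (i + 2))

variable {L P}

theorem hasLineDerivAt_evalOverPrefactor_P {U : Set ℂ} (hL : IsLogBranch L U)
    (hP : ∀ j, dot (P j) (P (j + 1)) ∈ U) (i : Fin 3) (x : Vec d) (q : MvPolynomial Block ℂ) :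
    HasLineDerivAt ℂ (fun P' => evalOverPrefactor L s Δ q P' Z)
      (dot x (gradPEval L s Δ P Z i q)) P (slot i x) := by
  have hA : dot (P i) (P (i + 1)) ∈ U := hP i
  have hB : dot (P i) (P (i + 2)) ∈ U := by
    have := hP (i + 2)
    rwa [label_add_two_add_one, dot_comm] at this
  have hA0 := hL.ne_zero hA
  have hB0 := hL.ne_zero hB
  -- Two of the three powers in the prefactor depend on `P_i`; each is differentiated by this
  -- formula.
  have key : ∀ (c : ℂ) (z : Vec d), dot (P i) z ∈ U →
      HasDerivAt (fun t : ℂ => Complex.exp (c * L (dot (P i + t • x) z)))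
        (Complex.exp (c * L (dot (P i) z)) * (c * ((dot (P i) z)⁻¹ * dot x z))) 0 := by
    intro c z hz
    have h1 : HasDerivAt L (dot (P i) z)⁻¹ (dot (P i + (0 : ℂ) • x) z) := by
      simpa using hL.hasDerivAt hz
    have h2 := ((h1.comp (0 : ℂ) (hasDerivAt_dot_line (P i) x z)).const_mul c).cexp
    simpa using h2
  have hq := hasDerivAt_aeval (fun b => hasLineDerivAt_blockValue_P i Z x hA0 hB0 b) q
  have h := hq.fun_div (((key (tau s Δ i) _ hA).mul_const
    (Complex.exp (tau s Δ (i + 1) * L (dot (P (i + 1)) (P (i + 2)))))).fun_mul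
      (key (tau s Δ (i + 2)) _ hB)) (by simp [Complex.exp_ne_zero])
  simp only [HasLineDerivAt, evalOverPrefactor, prod_labels i, shift_self, shift_add_one,
    shift_add_two, label_add_one_add_one, label_add_two_add_one, dot_comm (P (i + 2))]
  simp only [dot_comm (P (i + 1)) (P (i + 2))] at h ⊢
  refine h.congr_deriv ?_
  simp only [gradPEval, evalOverPrefactor, prod_labels i, dot_sub_right, dot_sum_right,
    dot_smul_right, dot_add_right, label_add_one_add_one, label_add_two_add_one, zero_smul,
    add_zero, dot_comm (P (i + 2)) (P i), dot_comm (P (i + 1)) (P (i + 2))]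
  simp only [div_mul_eq_mul_div, ← Finset.sum_div]
  have h1 := Complex.exp_ne_zero (tau s Δ i * L (dot (P i) (P (i + 1))))
  have h2 := Complex.exp_ne_zero (tau s Δ (i + 1) * L (dot (P (i + 2)) (P (i + 1))))
  have h3 := Complex.exp_ne_zero (tau s Δ (i + 2) * L (dot (P i) (P (i + 2))))
  field_simp

end Evaluation

/-! ### The differential operators on the polynomial ring. -/

section Operators

/-- The commutator of two derivations is a derivation, and this one kills every variable. -/
theorem pderiv_comm {σ : Type*} (b c : σ) (q : MvPolynomial σ ℂ) :
    pderiv b (pderiv c q) = pderiv c (pderiv b q) := by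
  have h : ⁅(pderiv b : Derivation ℂ (MvPolynomial σ ℂ) (MvPolynomial σ ℂ)),
      (pderiv c : Derivation ℂ (MvPolynomial σ ℂ) (MvPolynomial σ ℂ))⁆ = 0 := by
    classical
    refine MvPolynomial.derivation_ext fun k => ?_
    simp only [Derivation.commutator_apply, pderiv_X, Derivation.zero_apply]
    rw [Pi.single_apply, Pi.single_apply]
    split_ifs <;> simp
  have := congrArg (fun D => D q) h
  simpa only [Derivation.commutator_apply, Derivation.zero_apply, sub_eq_zero] using this

/-- Multiplication by a variable, as a differential operator. -/
def mulX (b : Block) : Module.End ℂ (MvPolynomial Block ℂ) :=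
  LinearMap.mulLeft ℂ (X b : MvPolynomial Block ℂ)

/-- The partial derivative with respect to a variable, as a differential operator. -/
def der (b : Block) : Module.End ℂ (MvPolynomial Block ℂ) :=
  ((pderiv b : Derivation ℂ (MvPolynomial Block ℂ) (MvPolynomial Block ℂ)) :
    MvPolynomial Block ℂ →ₗ[ℂ] MvPolynomial Block ℂ)

@[simp] theorem mulX_apply (b : Block) (q : MvPolynomial Block ℂ) : mulX b q = X b * q := rfl

@[simp] theorem der_apply (b : Block) (q : MvPolynomial Block ℂ) : der b q = pderiv b q := rfl

theorem mulX_mem (b : Block) : mulX b ∈ diffOps :=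
  Algebra.subset_adjoin (Or.inl ⟨b, rfl⟩)

theorem der_mem (b : Block) : der b ∈ diffOps :=
  Algebra.subset_adjoin (Or.inr ⟨b, rfl⟩)

/-- The operator that counts the spin at the `i`th point. -/
def spinOp (i : Fin 3) : Module.End ℂ (MvPolynomial Block ℂ) :=
  mulX (Sum.inr i) * der (Sum.inr i) + mulX (Sum.inl i) * der (Sum.inl i) +
    mulX (Sum.inl (i + 2)) * der (Sum.inl (i + 2))

theorem spinOp_mem (i : Fin 3) : spinOp i ∈ diffOps :=
  add_mem (add_mem (mul_mem (mulX_mem _) (der_mem _)) (mul_mem (mulX_mem _) (der_mem _)))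
    (mul_mem (mulX_mem _) (der_mem _))

/-- The operator on polynomials in the blocks that represents the Laplacian
`∂²/(∂Z_i·∂Z_i)`, up to the factor `-2 (P_i·P_{i+1}) (P_i·P_{i+2}) / (P_{i+1}·P_{i+2})`. -/
def laplaceOp (i : Fin 3) : Module.End ℂ (MvPolynomial Block ℂ) :=
  der (Sum.inr i) * der (Sum.inr i)
    - (2 : ℂ) • (mulX (Sum.inr (i + 1)) * der (Sum.inr i) * der (Sum.inl i))
    - (2 : ℂ) • (mulX (Sum.inr (i + 2)) * der (Sum.inr i) * der (Sum.inl (i + 2)))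
    + (2 : ℂ) • ((mulX (Sum.inl (i + 1)) +
        (2 : ℂ) • (mulX (Sum.inr (i + 1)) * mulX (Sum.inr (i + 2)))) *
      der (Sum.inl i) * der (Sum.inl (i + 2)))

theorem laplaceOp_mem (i : Fin 3) : laplaceOp i ∈ diffOps := by
  unfold laplaceOp
  repeat' with_reducible first
    | exact mulX_mem _ | exact der_mem _
    | apply Subalgebra.smul_mem | apply mul_mem | apply add_mem | apply sub_mem

/-- The part of `∂_{P_i}·D_{Z_i}` that is expressible in terms of the blocks, where the operators
`C`, `A`, `B` stand for the numbers `d/2 - 2 + s_i` and the exponents of `P_i·P_{i+1}`,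
`P_i·P_{i+2}` in the prefactor. -/
def divergenceOp (i : Fin 3) (C A B : Module.End ℂ (MvPolynomial Block ℂ)) :
    Module.End ℂ (MvPolynomial Block ℂ) :=
  ((mulX (Sum.inl (i + 2)) + (2 : ℂ) • (mulX (Sum.inr i) * mulX (Sum.inr (i + 2)))) *
      der (Sum.inr i) * der (Sum.inl (i + 2))
    - (mulX (Sum.inl i) + (2 : ℂ) • (mulX (Sum.inr i) * mulX (Sum.inr (i + 1)))) *
      der (Sum.inr i) * der (Sum.inl i)
    + (2 : ℂ) • ((mulX (Sum.inr (i + 2)) * mulX (Sum.inl i) -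
        mulX (Sum.inr (i + 1)) * mulX (Sum.inl (i + 2))) * der (Sum.inl i) * der (Sum.inl (i + 2)))
    - mulX (Sum.inr (i + 1)) * der (Sum.inr (i + 1)) * der (Sum.inr i)
    + mulX (Sum.inr (i + 2)) * der (Sum.inr (i + 2)) * der (Sum.inr i)
    + (2 : ℂ) • (mulX (Sum.inr (i + 1)) * mulX (Sum.inr (i + 1)) * der (Sum.inr (i + 1)) *
        der (Sum.inl i))
    + mulX (Sum.inl (i + 1)) * der (Sum.inr (i + 2)) * der (Sum.inl i)
    - mulX (Sum.inl (i + 1)) * der (Sum.inr (i + 1)) * der (Sum.inl (i + 2))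
    - (2 : ℂ) • (mulX (Sum.inr (i + 2)) * mulX (Sum.inr (i + 2)) * der (Sum.inr (i + 2)) *
        der (Sum.inl (i + 2)))
    + der (Sum.inr i) * (A - B)
    + (2 : ℂ) • (mulX (Sum.inr (i + 1)) * der (Sum.inl i) * B)
    - (2 : ℂ) • (mulX (Sum.inr (i + 2)) * der (Sum.inl (i + 2)) * A)) * C
  + ((1 / 2 : ℂ) • (mulX (Sum.inr i) * laplaceOp i * (B - A))
    + ((1 / 2 : ℂ) • mulX (Sum.inl i) + mulX (Sum.inr i) * mulX (Sum.inr (i + 1))) *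
      der (Sum.inr (i + 1)) * laplaceOp i
    - ((1 / 2 : ℂ) • mulX (Sum.inl (i + 2)) + mulX (Sum.inr i) * mulX (Sum.inr (i + 2))) *
      der (Sum.inr (i + 2)) * laplaceOp i)

theorem divergenceOp_mem (i : Fin 3) {C A B : Module.End ℂ (MvPolynomial Block ℂ)}
    (hC : C ∈ diffOps) (hA : A ∈ diffOps) (hB : B ∈ diffOps) :
    divergenceOp i C A B ∈ diffOps := by
  unfold divergenceOp
  repeat' with_reducible first
    | exact hA | exact hB | exact hC | exact mulX_mem _ | exact der_mem _ | exact laplaceOp_mem _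
    | apply Subalgebra.smul_mem | apply mul_mem | apply add_mem | apply sub_mem

/-- The three admissible variables are those linear in `Z_i`, so each derivative lowers the spin at
the `i`th point by one. -/
theorem spinOp_pderiv (i : Fin 3) {q : MvPolynomial Block ℂ} {n : ℂ} (hq : spinOp i q = n • q)
    {b : Block} (hb : b = Sum.inr i ∨ b = Sum.inl i ∨ b = Sum.inl (i + 2)) :
    spinOp i (pderiv b q) = (n - 1) • pderiv b q := by
  have h := congrArg (pderiv b) hq
  have h02 : i ≠ i + 2 := (label_add_two_ne i).symm
  have h20 : i + 2 ≠ i := label_add_two_ne i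
  simp only [spinOp, LinearMap.add_apply, Module.End.mul_apply, mulX_apply, der_apply, map_add,
    Derivation.leibniz, smul_eq_mul, Derivation.map_smul] at h ⊢
  rw [sub_smul, one_smul, ← h, pderiv_comm b (Sum.inr i), pderiv_comm b (Sum.inl i),
    pderiv_comm b (Sum.inl (i + 2))]
  rcases hb with rfl | rfl | rfl
  · rw [pderiv_X_self, pderiv_X_of_ne (by simp), pderiv_X_of_ne (by simp)]
    ring
  · rw [pderiv_X_self, pderiv_X_of_ne (by simp), pderiv_X_of_ne (by simp)]
    ring
  · rw [pderiv_X_self, pderiv_X_of_ne (by simp), pderiv_X_of_ne (by simp)]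
    ring

end Operators

/-! ### The Thomas–Todorov operator in terms of the blocks. -/

section Divergence

variable {d : ℕ} (L : ℂ → ℂ) (s : Fin 3 → ℕ) (Δ : Fin 3 → ℂ) (P Z : Triple d) (i : Fin 3)
  {q : MvPolynomial Block ℂ} {n : ℂ}

theorem evalOverPrefactor_laplaceOp (q : MvPolynomial Block ℂ) :
    evalOverPrefactor L s Δ (laplaceOp i q) P Z =
      evalOverPrefactor L s Δ (pderiv (Sum.inr i) (pderiv (Sum.inr i) q)) P Z
      - 2 * blockValue P Z (Sum.inr (i + 1)) *
        evalOverPrefactor L s Δ (pderiv (Sum.inr i) (pderiv (Sum.inl i) q)) P Z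
      - 2 * blockValue P Z (Sum.inr (i + 2)) *
        evalOverPrefactor L s Δ (pderiv (Sum.inr i) (pderiv (Sum.inl (i + 2)) q)) P Z
      + 2 * (blockValue P Z (Sum.inl (i + 1)) + 2 * blockValue P Z (Sum.inr (i + 1)) *
          blockValue P Z (Sum.inr (i + 2))) *
        evalOverPrefactor L s Δ (pderiv (Sum.inl i) (pderiv (Sum.inl (i + 2)) q)) P Z := by
  simp only [laplaceOp, LinearMap.add_apply, LinearMap.sub_apply, LinearMap.smul_apply,
    Module.End.mul_apply, mulX_apply, der_apply, evalOverPrefactor_add, evalOverPrefactor_sub,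
    evalOverPrefactor_smul, evalOverPrefactor_mul, aeval_X]
  ring

theorem evalOverPrefactor_spinOp (q : MvPolynomial Block ℂ) :
    evalOverPrefactor L s Δ (spinOp i q) P Z =
      blockValue P Z (Sum.inr i) * evalOverPrefactor L s Δ (pderiv (Sum.inr i) q) P Z
      + blockValue P Z (Sum.inl i) * evalOverPrefactor L s Δ (pderiv (Sum.inl i) q) P Z
      + blockValue P Z (Sum.inl (i + 2)) *
        evalOverPrefactor L s Δ (pderiv (Sum.inl (i + 2)) q) P Z := by
  simp only [spinOp, LinearMap.add_apply,
    Module.End.mul_apply, mulX_apply, der_apply, evalOverPrefactor_add, evalOverPrefactor_mul,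
    aeval_X]

/-- By Euler's identity `Z·∂_Z` acts on a first derivative as `n - 1`, whence `d/2 - 2 + n`. The
Laplacian is `-2κ` times `laplaceOp`, so the factor `-1/2` leaves `κ`. No condition on the `i`th
point is assumed, so the formula can still be differentiated in `P_i`. -/
theorem thomasTodorov_of_spinOp (hq : spinOp i q = n • q) (a : Fin (d + 2))
    (hA : dot (P (i + 1)) (P (i + 1)) = 0) (hB : dot (P (i + 2)) (P (i + 2)) = 0)
    (hAα : dot (P (i + 1)) (Z (i + 1)) = 0) (hBβ : dot (P (i + 2)) (Z (i + 2)) = 0)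
    (hα : dot (Z (i + 1)) (Z (i + 1)) = 0) (hβ : dot (Z (i + 2)) (Z (i + 2)) = 0)
    (hAB : dot (P (i + 1)) (P (i + 2)) ≠ 0) (hPA : dot (P i) (P (i + 1)) ≠ 0)
    (hPB : dot (P i) (P (i + 2)) ≠ 0) :
    thomasTodorov i a (evalOverPrefactor L s Δ q) P Z = eta a *
      (((d : ℂ) / 2 - 2 + n) *
        (evalOverPrefactor L s Δ (pderiv (Sum.inr i) q) P Z *
            gradZV (P i) (P (i + 1)) (P (i + 2)) a +
          evalOverPrefactor L s Δ (pderiv (Sum.inl i) q) P Z *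
            gradZH (P i) (P (i + 1)) (Z (i + 1)) a +
          evalOverPrefactor L s Δ (pderiv (Sum.inl (i + 2)) q) P Z *
            gradZH (P i) (P (i + 2)) (Z (i + 2)) a) +
        dot (P i) (P (i + 1)) * dot (P i) (P (i + 2)) / dot (P (i + 1)) (P (i + 2)) *
          evalOverPrefactor L s Δ (laplaceOp i q) P Z * Z i a) := by
  have hu := congrArg (fun q => evalOverPrefactor L s Δ q P Z)
    (spinOp_pderiv i hq (Or.inl rfl))
  have hp := congrArg (fun q => evalOverPrefactor L s Δ q P Z)
    (spinOp_pderiv i hq (Or.inr (Or.inl rfl)))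
  have hr := congrArg (fun q => evalOverPrefactor L s Δ q P Z)
    (spinOp_pderiv i hq (Or.inr (Or.inr rfl)))
  simp only [evalOverPrefactor_spinOp, evalOverPrefactor_smul] at hu hp hr
  rw [thomasTodorov_evalOverPrefactor]
  simp only [sum_blocks i, gradZ_inl_self, gradZ_inl_add_one, gradZ_inl_add_two, gradZ_inr_self,
    gradZ_inr_add_one, gradZ_inr_add_two, dot_zero_left, dot_zero_right, Pi.zero_apply, mul_zero,
    add_zero]
  rw [evalOverPrefactor_laplaceOp]
  simp only [dot_self_gradZV, dot_self_gradZH, dot_gradZV_self hA hB hAB,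
    dot_gradZH_self hA hAα hα, dot_gradZH_self hB hBβ hβ, dot_gradZV_gradZH hA hAα hAB hPB,
    dot_gradZV_gradZH' hB hBβ hAB hPA, dot_gradZH_gradZH hAB hPA hPB,
    dot_comm (gradZH (P i) (P (i + 1)) (Z (i + 1))) (gradZV (P i) (P (i + 1)) (P (i + 2))),
    dot_comm (gradZH (P i) (P (i + 2)) (Z (i + 2))) (gradZV (P i) (P (i + 1)) (P (i + 2))),
    dot_comm (gradZH (P i) (P (i + 2)) (Z (i + 2))) (gradZH (P i) (P (i + 1)) (Z (i + 1)))]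
  simp only [← blockValue_inl_self, ← blockValue_inl_add_one, ← blockValue_inl_add_two,
    ← blockValue_inr_self, ← blockValue_inr_add_one, ← blockValue_inr_add_two]
  rw [pderiv_comm (Sum.inl i) (Sum.inr i), pderiv_comm (Sum.inl (i + 2)) (Sum.inr i),
    pderiv_comm (Sum.inl (i + 2)) (Sum.inl i)] at *
  linear_combination eta a * (gradZV (P i) (P (i + 1)) (P (i + 2)) a * hu +
    gradZH (P i) (P (i + 1)) (Z (i + 1)) a * hp + gradZH (P i) (P (i + 2)) (Z (i + 2)) a * hr)

end Divergence

/-! ### The divergence and its obstruction term. -/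

section Divergence

variable {d : ℕ} {L : ℂ → ℂ} {U : Set ℂ} (s : Fin 3 → ℕ) (Δ : Fin 3 → ℂ) {P Z : Triple d}
  (i : Fin 3) {q : MvPolynomial Block ℂ} {n : ℂ}

/-- The gradient is an antisymmetric matrix applied to `P`, so its component `a` does not involve
`P^a`. The gradients therefore contribute nothing when `∂/∂P^a` is contracted with them. -/
theorem gradZV_shift_apply (P A B : Vec d) (a : Fin (d + 2)) (t : ℂ) :
    gradZV (P + t • Pi.single a 1) A B a = gradZV P A B a := by
  simp only [gradZV, dot_add_left, dot_smul_left, dot_single_left, Pi.sub_apply, Pi.smul_apply,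
    smul_eq_mul]
  ring

theorem gradZH_shift_apply (P A α : Vec d) (a : Fin (d + 2)) (t : ℂ) :
    gradZH (P + t • Pi.single a 1) A α a = gradZH P A α a := by
  simp only [gradZH, dot_add_left, dot_smul_left, dot_single_left, Pi.add_apply, Pi.smul_apply,
    smul_eq_mul]
  ring

theorem eventually_dot_shift_ne_zero {x z : Vec d} (y : Vec d) (h : dot x z ≠ 0) :
    ∀ᶠ t in nhds (0 : ℂ), dot (x + t • y) z ≠ 0 := by
  have hc := (hasDerivAt_dot_line x y z).continuousAt
  refine hc.eventually_ne ?_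
  simpa using h

/-- Since the gradient components are constant along the matching coordinate of `P_i`, `∂_{P_i}`
falls only on the evaluated polynomials and on `κ`. The derivative of `κ` along `Z_i` is `w_A +
w_B`, which gives the last term. -/
theorem divergence_eq_gradPEval (hL : IsLogBranch L U) (hloc : OnLocus P Z)
    (hP : ∀ j, dot (P j) (P (j + 1)) ∈ U) (hq : spinOp i q = n • q) :
    divergence i (evalOverPrefactor L s Δ q) P Z =
      ((d : ℂ) / 2 - 2 + n) *
        (dot (gradZV (P i) (P (i + 1)) (P (i + 2)))
            (gradPEval L s Δ P Z i (pderiv (Sum.inr i) q)) +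
          dot (gradZH (P i) (P (i + 1)) (Z (i + 1)))
            (gradPEval L s Δ P Z i (pderiv (Sum.inl i) q)) +
          dot (gradZH (P i) (P (i + 2)) (Z (i + 2)))
            (gradPEval L s Δ P Z i (pderiv (Sum.inl (i + 2)) q))) +
      dot (P i) (P (i + 1)) * dot (P i) (P (i + 2)) / dot (P (i + 1)) (P (i + 2)) *
        dot (Z i) (gradPEval L s Δ P Z i (laplaceOp i q)) +
      (dot (Z i) (P (i + 1)) * dot (P i) (P (i + 2)) / dot (P (i + 1)) (P (i + 2)) +
        dot (Z i) (P (i + 2)) * dot (P i) (P (i + 1)) / dot (P (i + 1)) (P (i + 2))) *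
        evalOverPrefactor L s Δ (laplaceOp i q) P Z := by
  have hPA : dot (P i) (P (i + 1)) ≠ 0 := hL.ne_zero (hP i)
  have hPB : dot (P i) (P (i + 2)) ≠ 0 := by
    have := hL.ne_zero (hP (i + 2))
    rwa [label_add_two_add_one, dot_comm] at this
  have hAB : dot (P (i + 1)) (P (i + 2)) ≠ 0 := by
    have := hL.ne_zero (hP (i + 1))
    rwa [label_add_one_add_one] at this
  obtain ⟨hA, hAα, hα⟩ := hloc (i + 1)
  obtain ⟨hB, hBβ, hβ⟩ := hloc (i + 2)
  have key : ∀ a, dP i a (thomasTodorov i a (evalOverPrefactor L s Δ q)) P Z = eta a *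
      (((d : ℂ) / 2 - 2 + n) *
        (dot (Pi.single a 1) (gradPEval L s Δ P Z i (pderiv (Sum.inr i) q)) *
            gradZV (P i) (P (i + 1)) (P (i + 2)) a +
          dot (Pi.single a 1) (gradPEval L s Δ P Z i (pderiv (Sum.inl i) q)) *
            gradZH (P i) (P (i + 1)) (Z (i + 1)) a +
          dot (Pi.single a 1) (gradPEval L s Δ P Z i (pderiv (Sum.inl (i + 2)) q)) *
            gradZH (P i) (P (i + 2)) (Z (i + 2)) a) +
        (((dot (Pi.single a 1) (P (i + 1)) * dot (P i) (P (i + 2)) +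
          dot (P i) (P (i + 1)) * dot (Pi.single a 1) (P (i + 2))) /
            dot (P (i + 1)) (P (i + 2))) * evalOverPrefactor L s Δ (laplaceOp i q) P Z +
          dot (P i) (P (i + 1)) * dot (P i) (P (i + 2)) / dot (P (i + 1)) (P (i + 2)) *
          dot (Pi.single a 1) (gradPEval L s Δ P Z i (laplaceOp i q))) * Z i a) := by
    intro a
    set e : Vec d := Pi.single a 1 with he
    have hg := hasLineDerivAt_evalOverPrefactor_P s Δ Z hL hP i e
    have hκ := ((hasDerivAt_dot_line (P i) e (P (i + 1))).fun_mul
      (hasDerivAt_dot_line (P i) e (P (i + 2)))).div_const (dot (P (i + 1)) (P (i + 2)))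
    have h1 := (((((hg (pderiv (Sum.inr i) q)).mul_const
        (gradZV (P i) (P (i + 1)) (P (i + 2)) a)).fun_add
      ((hg (pderiv (Sum.inl i) q)).mul_const
        (gradZH (P i) (P (i + 1)) (Z (i + 1)) a))).fun_add
      ((hg (pderiv (Sum.inl (i + 2)) q)).mul_const
        (gradZH (P i) (P (i + 2)) (Z (i + 2)) a))).const_mul ((d : ℂ) / 2 - 2 + n)).fun_add
      ((hκ.fun_mul (hg (laplaceOp i q))).mul_const (Z i a))
    have h2 := h1.const_mul (eta a)
    -- The shifted point may leave the locus at label `i`. The formula for the Thomas–Todorov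
    -- operator needs only the other two labels and non-zero denominators, which persist for small
    -- `t`.
    have h3 := h2.congr_of_eventuallyEq (f₁ := fun t : ℂ =>
        thomasTodorov i a (evalOverPrefactor L s Δ q) (P + t • slot i e) Z) (by
      filter_upwards [eventually_dot_shift_ne_zero e hPA, eventually_dot_shift_ne_zero e hPB]
        with t htA htB
      rw [thomasTodorov_of_spinOp L s Δ _ Z i hq a]
      all_goals try simp only [shift_self, shift_add_one, shift_add_two]
      · rw [he, gradZV_shift_apply, gradZH_shift_apply, gradZH_shift_apply]
      all_goals assumption)
    refine h3.deriv.trans ?_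
    simp only [zero_smul, add_zero]
  simp only [divergence, key, ← mul_assoc (eta _) (eta _), eta_mul_eta, one_mul]
  simp only [← sum_dot_single_mul _ (gradZV _ _ _), ← sum_dot_single_mul _ (gradZH _ _ _),
    ← sum_dot_single_mul _ (Z i), Finset.sum_add_distrib, Finset.mul_sum, Finset.sum_mul,
    Finset.sum_div, mul_add, add_mul, add_div]
  simp only [← Finset.sum_add_distrib]
  exact Finset.sum_congr rfl fun a _ => by ring

/-- In `divergenceOp` the operators `C`, `A`, `B` act before any derivative, so it suffices that `q`
is an eigenvector of each. -/
theorem evalOverPrefactor_divergenceOp (L : ℂ → ℂ) (P Z : Triple d)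
    {A B C : Module.End ℂ (MvPolynomial Block ℂ)} {a b c : ℂ}
    (hA : A q = a • q) (hB : B q = b • q) (hC : C q = c • q) :
    evalOverPrefactor L s Δ (divergenceOp i C A B q) P Z =
      c * ((blockValue P Z (Sum.inl (i + 2)) +
          2 * blockValue P Z (Sum.inr i) * blockValue P Z (Sum.inr (i + 2))) *
          evalOverPrefactor L s Δ (pderiv (Sum.inr i) (pderiv (Sum.inl (i + 2)) q)) P Z
        - (blockValue P Z (Sum.inl i) +
          2 * blockValue P Z (Sum.inr i) * blockValue P Z (Sum.inr (i + 1))) *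
          evalOverPrefactor L s Δ (pderiv (Sum.inr i) (pderiv (Sum.inl i) q)) P Z
        + 2 * (blockValue P Z (Sum.inr (i + 2)) * blockValue P Z (Sum.inl i) -
          blockValue P Z (Sum.inr (i + 1)) * blockValue P Z (Sum.inl (i + 2))) *
          evalOverPrefactor L s Δ (pderiv (Sum.inl i) (pderiv (Sum.inl (i + 2)) q)) P Z
        - blockValue P Z (Sum.inr (i + 1)) *
          evalOverPrefactor L s Δ (pderiv (Sum.inr (i + 1)) (pderiv (Sum.inr i) q)) P Z
        + blockValue P Z (Sum.inr (i + 2)) *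
          evalOverPrefactor L s Δ (pderiv (Sum.inr (i + 2)) (pderiv (Sum.inr i) q)) P Z
        + 2 * blockValue P Z (Sum.inr (i + 1)) ^ 2 *
          evalOverPrefactor L s Δ (pderiv (Sum.inr (i + 1)) (pderiv (Sum.inl i) q)) P Z
        + blockValue P Z (Sum.inl (i + 1)) *
          evalOverPrefactor L s Δ (pderiv (Sum.inr (i + 2)) (pderiv (Sum.inl i) q)) P Z
        - blockValue P Z (Sum.inl (i + 1)) *
          evalOverPrefactor L s Δ (pderiv (Sum.inr (i + 1)) (pderiv (Sum.inl (i + 2)) q)) P Z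
        - 2 * blockValue P Z (Sum.inr (i + 2)) ^ 2 *
          evalOverPrefactor L s Δ (pderiv (Sum.inr (i + 2)) (pderiv (Sum.inl (i + 2)) q)) P Z
        + (a - b) * evalOverPrefactor L s Δ (pderiv (Sum.inr i) q) P Z
        + 2 * b * blockValue P Z (Sum.inr (i + 1)) *
          evalOverPrefactor L s Δ (pderiv (Sum.inl i) q) P Z
        - 2 * a * blockValue P Z (Sum.inr (i + 2)) *
          evalOverPrefactor L s Δ (pderiv (Sum.inl (i + 2)) q) P Z)
      + (1 / 2 * (b - a) * blockValue P Z (Sum.inr i) *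
          evalOverPrefactor L s Δ (laplaceOp i q) P Z
        + (1 / 2 * blockValue P Z (Sum.inl i) +
            blockValue P Z (Sum.inr i) * blockValue P Z (Sum.inr (i + 1))) *
          evalOverPrefactor L s Δ (pderiv (Sum.inr (i + 1)) (laplaceOp i q)) P Z
        - (1 / 2 * blockValue P Z (Sum.inl (i + 2)) +
            blockValue P Z (Sum.inr i) * blockValue P Z (Sum.inr (i + 2))) *
          evalOverPrefactor L s Δ (pderiv (Sum.inr (i + 2)) (laplaceOp i q)) P Z) := by
  have hBA : (B - A) q = (b - a) • q := by rw [LinearMap.sub_apply, hA, hB, sub_smul]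
  simp only [divergenceOp, LinearMap.add_apply, LinearMap.sub_apply, LinearMap.smul_apply,
    Module.End.mul_apply, hA, hB, hC, mulX_apply, der_apply, map_smul,
    ← sub_smul,
    evalOverPrefactor_add, evalOverPrefactor_sub, evalOverPrefactor_smul, evalOverPrefactor_mul,
    aeval_X, add_mul, smul_mul_assoc, mul_assoc, smul_add, smul_sub]
  ring

/-- Three sources feed the coefficient of `w_A + w_B`: products of gradients give `d/2 - 2 + n`, the
derivative of `κ` gives `1`, and the prefactor gives `-(τ_i w_A + τ_{i+2} w_B)`, whose symmetric
part is `-(τ_i + τ_{i+2})/2`. Its antisymmetric part is a multiple of `V_i` and belongs to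
`divergenceOp`. -/
theorem divergence_evalOverPrefactor (hL : IsLogBranch L U) (hloc : OnLocus P Z)
    (hP : ∀ j, dot (P j) (P (j + 1)) ∈ U) (hq : spinOp i q = n • q)
    {A B C : Module.End ℂ (MvPolynomial Block ℂ)}
    (hA : A q = tau s Δ i • q) (hB : B q = tau s Δ (i + 2) • q)
    (hC : C q = ((d : ℂ) / 2 - 2 + n) • q) :
    divergence i (evalOverPrefactor L s Δ q) P Z =
      evalOverPrefactor L s Δ (divergenceOp i C A B q) P Z +
      ((d : ℂ) / 2 - 1 + n - (tau s Δ i + tau s Δ (i + 2)) / 2) *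
      (dot (Z i) (P (i + 1)) * dot (P i) (P (i + 2)) / dot (P (i + 1)) (P (i + 2)) +
        dot (Z i) (P (i + 2)) * dot (P i) (P (i + 1)) / dot (P (i + 1)) (P (i + 2))) *
        evalOverPrefactor L s Δ (laplaceOp i q) P Z := by
  rw [divergence_eq_gradPEval s Δ i hL hloc hP hq,
    evalOverPrefactor_divergenceOp s Δ i L P Z hA hB hC]
  have hPA : dot (P i) (P (i + 1)) ≠ 0 := hL.ne_zero (hP i)
  have hPB : dot (P i) (P (i + 2)) ≠ 0 := by
    have := hL.ne_zero (hP (i + 2))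
    rwa [label_add_two_add_one, dot_comm] at this
  have hAB : dot (P (i + 1)) (P (i + 2)) ≠ 0 := by
    have := hL.ne_zero (hP (i + 1))
    rwa [label_add_one_add_one] at this
  obtain ⟨hA, hAα, hα⟩ := hloc (i + 1)
  obtain ⟨hB, hBβ, hβ⟩ := hloc (i + 2)
  have hnext : dot (P i) (P (i + 1)) * dot (P i) (P (i + 2)) / dot (P (i + 1)) (P (i + 2)) *
      dot (Z i) (gradPVnext (P i) (P (i + 1)) (P (i + 2)) (Z (i + 1))) = _ :=
    dot_self_gradPVnext hAB hPB
  have hprev : dot (P i) (P (i + 1)) * dot (P i) (P (i + 2)) / dot (P (i + 1)) (P (i + 2)) *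
      dot (Z i) (gradPVprev (P i) (P (i + 1)) (P (i + 2)) (Z (i + 2))) = _ :=
    dot_self_gradPVprev hAB hPA
  have hG := evalOverPrefactor_laplaceOp L s Δ P Z i q
  have huu : blockValue P Z (Sum.inr i) =
      dot (Z i) (P (i + 1)) * dot (P i) (P (i + 2)) / dot (P (i + 1)) (P (i + 2)) -
        dot (Z i) (P (i + 2)) * dot (P i) (P (i + 1)) / dot (P (i + 1)) (P (i + 2)) := by
    rw [blockValue_inr_self, structV]
    ring
  simp only [gradPEval, dot_sub_right, dot_add_right, dot_smul_right, sum_blocks i,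
    gradP_inl_self, gradP_inl_add_one, gradP_inl_add_two, gradP_inr_self, gradP_inr_add_one,
    gradP_inr_add_two, dot_zero_right, dot_gradZV_gradPV hA hB hAB, dot_gradZH_gradPV hA hAα hPB,
    dot_gradZH_gradPV' hB hBβ hPA, dot_gradZV_gradPH hA hAα hAB hPB,
    dot_gradZV_gradPH' hB hBβ hAB hPA, dot_gradZH_gradPH_self hA hAα hα,
    dot_gradZH_gradPH_self hB hBβ hβ, dot_gradZH_gradPH hAB hPA hPB,
    dot_gradZH_gradPH' hAB hPA hPB, dot_gradZV_gradPVnext hA hB hAα hAB hPB,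
    dot_gradZV_gradPVprev hA hB hBβ hAB hPA, dot_gradZH_gradPVnext hA hAα hα hPB,
    dot_gradZH_gradPVprev' hB hBβ hβ hPA, dot_gradZH_gradPVprev hA hAα hPA hPB,
    dot_gradZH_gradPVnext' hB hBβ hPA hPB, dot_self_gradPV, dot_self_gradPH,
    gradZV_dot_left hA hAB, gradZV_dot_right hB hAB, gradZH_dot_self hA hAα,
    gradZH_dot_self hB hBβ, gradZH_dot_left hPA, gradZH_dot_right hPB]
  simp only [← blockValue_inl_self, ← blockValue_inl_add_one, ← blockValue_inl_add_two,
    ← blockValue_inr_self, ← blockValue_inr_add_one, ← blockValue_inr_add_two] at *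
  rw [pderiv_comm (Sum.inl i) (Sum.inr i), pderiv_comm (Sum.inl (i + 2)) (Sum.inr i),
    pderiv_comm (Sum.inl (i + 2)) (Sum.inl i)] at *
  -- Writing the exponents as multiples of the scalar products removes the divisions in the gradient
  -- of the prefactor.
  obtain ⟨a, ha⟩ : ∃ a, tau s Δ i = a * dot (P i) (P (i + 1)) := ⟨_, (div_mul_cancel₀ _ hPA).symm⟩
  obtain ⟨b, hb⟩ : ∃ b, tau s Δ (i + 2) = b * dot (P i) (P (i + 2)) :=
    ⟨_, (div_mul_cancel₀ _ hPB).symm⟩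
  rw [ha, hb, mul_div_cancel_right₀ _ hPA, mul_div_cancel_right₀ _ hPB]
  rw [huu] at hnext hprev ⊢
  -- The Laplacian identity collects the terms in `w_A + w_B`; the other two identities eliminate
  -- the contractions of `Z_i` with the gradients of the neighbouring `V`s.
  linear_combination
    -((d : ℂ) / 2 - 2 + n) *
      (dot (Z i) (P (i + 1)) * dot (P i) (P (i + 2)) / dot (P (i + 1)) (P (i + 2)) +
        dot (Z i) (P (i + 2)) * dot (P i) (P (i + 1)) / dot (P (i + 1)) (P (i + 2))) * hG +
    evalOverPrefactor L s Δ (pderiv (Sum.inr (i + 1)) (laplaceOp i q)) P Z * hnext +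
    evalOverPrefactor L s Δ (pderiv (Sum.inr (i + 2)) (laplaceOp i q)) P Z * hprev

end Divergence

/-! ### Sufficiency: one operator for all spins. -/

section Sufficiency

theorem blockMonomial_eq_monomial (h v : Fin 3 → ℕ) :
    blockMonomial h v = monomial (Finsupp.equivFunOnFinite.symm (Sum.elim h v)) 1 := by
  rw [monomial_eq, Finsupp.prod_fintype _ _ (by simp), Fintype.prod_sum_type, blockMonomial,
    Finset.prod_mul_distrib]
  simp

theorem X_mul_pderiv_blockMonomial (h v : Fin 3 → ℕ) (b : Block) :
    X b * pderiv b (blockMonomial h v) = ((Sum.elim h v b : ℕ) : ℂ) • blockMonomial h v := by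
  rw [blockMonomial_eq_monomial, X_mul_pderiv_monomial, Nat.cast_smul_eq_nsmul]
  rfl

theorem spinOp_blockMonomial (i : Fin 3) (h v : Fin 3 → ℕ) :
    spinOp i (blockMonomial h v) =
      ((v i + h i + h (i + 2) : ℕ) : ℂ) • blockMonomial h v := by
  simp only [spinOp, LinearMap.add_apply, Module.End.mul_apply, mulX_apply, der_apply,
    X_mul_pderiv_blockMonomial, ← add_smul, Sum.elim_inl, Sum.elim_inr, Nat.cast_add]

theorem tau_add_two (s : Fin 3 → ℕ) (Δ : Fin 3 → ℂ) (i : Fin 3) :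
    tau s Δ (i + 2) =
      ((s (i + 2) : ℂ) + s i - s (i + 1) + Δ (i + 2) + Δ i - Δ (i + 1)) / 2 := by
  rw [tau, label_add_two_add_one, label_add_two_add_two]

theorem exists_reproduces (d : ℕ) (i : Fin 3) (Δ : Fin 3 → ℂ) :
    ∃ D ∈ diffOps, ∀ (s : Fin 3 → ℕ) (Δ' : Fin 3 → ℂ),
      Δ' i = (d : ℂ) - 1 + ((s i : ℂ) - 1) → (∀ j, j ≠ i → Δ' j = Δ j) →
        Reproduces d i s Δ' D := by
  have hscal : ∀ c : ℂ, algebraMap ℂ (Module.End ℂ (MvPolynomial Block ℂ)) c ∈ diffOps :=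
    fun c => diffOps.algebraMap_mem c
  -- These are `d/2 - 2 + s_i`, `τ_i` and `τ_{i+2}` with `Δ_i = d - 2 + s_i` inserted and each spin
  -- replaced by its counting operator. The spin `s_i` occurs twice in an exponent, once explicitly
  -- and once through `Δ_i`.
  refine ⟨divergenceOp i (algebraMap ℂ _ ((d : ℂ) / 2 - 2) + spinOp i)
    (algebraMap ℂ _ (((d : ℂ) - 2 + Δ (i + 1) - Δ (i + 2)) / 2) +
      ((1 / 2 : ℂ) • (spinOp i + spinOp i + spinOp (i + 1) - spinOp (i + 2))))
    (algebraMap ℂ _ (((d : ℂ) - 2 + Δ (i + 2) - Δ (i + 1)) / 2) +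
      ((1 / 2 : ℂ) • (spinOp i + spinOp i + spinOp (i + 2) - spinOp (i + 1)))), ?_, ?_⟩
  · apply divergenceOp_mem
    all_goals
      repeat' with_reducible first
        | exact hscal _ | exact spinOp_mem _
        | apply Subalgebra.smul_mem | apply add_mem | apply sub_mem
  · intro s Δ' hi hΔ h v hs L U hL P Z hloc hP
    have h1 : Δ' (i + 1) = Δ (i + 1) := hΔ _ (label_add_one_ne i)
    have h2 : Δ' (i + 2) = Δ (i + 2) := hΔ _ (label_add_two_ne i)
    have hspin : ∀ j, spinOp j (blockMonomial h v) = (s j : ℂ) • blockMonomial h v := fun j => by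
      rw [spinOp_blockMonomial, hs j]
    rw [divergence_evalOverPrefactor s Δ' i hL hloc hP (hspin i)]
    -- The obstruction coefficient vanishes at this dimension.
    · rw [tau_add_two, tau, hi]
      ring
    · simp only [LinearMap.add_apply, LinearMap.sub_apply, LinearMap.smul_apply, hspin,
        Module.algebraMap_end_apply, ← add_smul, ← sub_smul, smul_smul]
      congr 1
      rw [tau, hi, h1, h2]
      ring
    · simp only [LinearMap.add_apply, LinearMap.sub_apply, LinearMap.smul_apply, hspin,
        Module.algebraMap_end_apply, ← add_smul, ← sub_smul, smul_smul]
      congr 1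
      rw [tau_add_two, hi, h1, h2]
      ring
    · simp only [LinearMap.add_apply, hspin, Module.algebraMap_end_apply, ← add_smul]

end Sufficiency

/-! ### Explicit points of the locus. -/

section Configurations

theorem isLogBranch_log : IsLogBranch Complex.log Complex.slitPlane :=
  ⟨Complex.isOpen_slitPlane, fun _ hz => (Complex.differentiableAt_log hz).differentiableWithinAt,
    fun _ hz => Complex.exp_log (Complex.slitPlane_ne_zero hz)⟩

/-- There are three null vectors with scalar products `1`, and a vector of square `2` that is
orthogonal to them. -/
theorem exists_null_frame {d : ℕ} (hd : 2 ≤ d) :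
    ∃ (P : Triple d) (e : Vec d), (∀ j, dot (P j) (P j) = 0) ∧
      (∀ j k, j ≠ k → dot (P j) (P k) = 1) ∧ (∀ j, dot (P j) e = 0) ∧ dot e e = 2 := by
  obtain ⟨k, rfl⟩ := Nat.exists_eq_add_of_le' hd
  obtain ⟨emb, hdot⟩ : ∃ emb : (Fin 4 → ℂ) → Vec (k + 2), ∀ x y, dot (emb x) (emb y) =
      -(x 0 * y 0) + x 1 * y 1 + x 2 * y 2 + x 3 * y 3 := by
    refine ⟨fun c => Fin.cons (c 0) (Fin.cons (c 1) (Fin.cons (c 2)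
      (Fin.cons (c 3) (0 : Fin k → ℂ)))), fun x y => ?_⟩
    simp only [dot, Fin.sum_univ_succ, Fin.cons_zero, Fin.cons_succ, Pi.zero_apply, eta,
      Fin.succ_ne_zero, if_true, if_false, mul_zero, Finset.sum_const_zero]
    ring
  -- The null vectors are `√-1` times the sum of the time vector and the `j`th of three spatial unit
  -- vectors; `e` has all four coordinates equal to one.
  refine ⟨fun j => emb fun a => if a = 0 ∨ a = j.succ then Complex.I else 0, emb 1, fun j => ?_,
    fun j l hjl => ?_, fun j => ?_, ?_⟩
  · simp only [hdot]
    fin_cases j <;> simp [Fin.ext_iff]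
  · simp only [hdot]
    fin_cases j <;> fin_cases l <;> simp [Fin.ext_iff] at hjl ⊢
  · simp only [hdot]
    fin_cases j <;> simp [Fin.ext_iff]
  · rw [hdot]
    norm_num

end Configurations

/-! ### Nilpotent commutators and extrapolation in an exponent. -/

section Nilpotency

/-- The commutator with an element of an algebra, as a linear map. -/
def commutatorMap {A : Type*} [Ring A] [Algebra ℂ A] (x : A) : A →ₗ[ℂ] A :=
  LinearMap.mulLeft ℂ x - LinearMap.mulRight ℂ x

theorem commutatorMap_apply {A : Type*} [Ring A] [Algebra ℂ A] (x T : A) :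
    commutatorMap x T = x * T - T * x := rfl

/-- The commutator with a variable acts on the values `D (g X^k)` as a finite difference. -/
theorem aeval_commutatorMap (b : Block) (x : Block → ℂ) (hx : x b = 1) (g : MvPolynomial Block ℂ)
    (T : Module.End ℂ (MvPolynomial Block ℂ)) (k : ℕ) :
    aeval x (commutatorMap (mulX b) T (g * X b ^ k)) =
      aeval x (T (g * X b ^ k)) - aeval x (T (g * X b ^ (k + 1))) := by
  have h : X b * (g * X b ^ k) = g * X b ^ (k + 1) := by ring
  rw [commutatorMap_apply, LinearMap.sub_apply, Module.End.mul_apply,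
    Module.End.mul_apply, mulX_apply, mulX_apply, map_sub, map_mul, aeval_X, hx, one_mul, h]

/-- The commutator is a derivation, so Leibniz' rule and induction on the total exponent apply. -/
theorem commutatorMap_pow_mul_eq_zero {A : Type*} [Ring A] [Algebra ℂ A] (x : A) :
    ∀ (k m n : ℕ), m + n = k → ∀ S T : A, (commutatorMap x ^ m) S = 0 →
      (commutatorMap x ^ n) T = 0 → (commutatorMap x ^ k) (S * T) = 0 := by
  intro k
  induction k with
  | zero =>
    intro m n h S T hS _
    obtain rfl : m = 0 := by omega
    simp_all
  | succ k ih =>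
    intro m n h S T hS hT
    rcases m with _ | m
    · have : S = 0 := by simpa using hS
      simp [this]
    rcases n with _ | n
    · have : T = 0 := by simpa using hT
      simp [this]
    have hl : commutatorMap x (S * T) =
        commutatorMap x S * T + S * commutatorMap x T := by
      simp only [commutatorMap_apply]
      noncomm_ring
    rw [pow_succ, Module.End.mul_apply, hl, map_add,
      ih m (n + 1) (by omega) _ _ (by rwa [pow_succ, Module.End.mul_apply] at hS) hT,
      ih (m + 1) n (by omega) _ _ hS (by rwa [pow_succ, Module.End.mul_apply] at hT), add_zero]

theorem exists_commutatorMap_pow_eq_zero (b : Block) {D : Module.End ℂ (MvPolynomial Block ℂ)}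
    (hD : D ∈ diffOps) :
    ∃ N, (commutatorMap (mulX b) ^ N) D = 0 := by
  have hmul : ∀ p : MvPolynomial Block ℂ,
      commutatorMap (mulX b) (LinearMap.mulLeft ℂ p) = 0 := by
    intro p
    refine LinearMap.ext fun q => ?_
    rw [commutatorMap_apply, LinearMap.sub_apply, Module.End.mul_apply,
      Module.End.mul_apply, mulX_apply, mulX_apply, LinearMap.mulLeft_apply,
      LinearMap.mulLeft_apply, LinearMap.zero_apply]
    ring
  unfold diffOps at hD
  induction hD using Algebra.adjoin_induction with
  | mem D hD =>
    rcases hD with ⟨c, rfl⟩ | ⟨c, rfl⟩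
    · exact ⟨1, by rw [pow_one]; exact hmul _⟩
    · refine ⟨2, ?_⟩
      rw [pow_two, Module.End.mul_apply]
      -- The commutator of a variable with a partial derivative is multiplication by a polynomial,
      -- which a second commutator kills.
      convert hmul (-pderiv c (X b)) using 2
      refine LinearMap.ext fun q => ?_
      rw [commutatorMap_apply, LinearMap.sub_apply, Module.End.mul_apply,
        Module.End.mul_apply, mulX_apply, mulX_apply, LinearMap.mulLeft_apply]
      simp only [Derivation.coeFn_coe, Derivation.leibniz, smul_eq_mul]
      ring
  | algebraMap c =>
    refine ⟨1, ?_⟩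
    rw [pow_one, commutatorMap_apply, Algebra.commutes, sub_self]
  | add S T _ _ hS hT =>
    obtain ⟨m, hm⟩ := hS
    obtain ⟨n, hn⟩ := hT
    refine ⟨m + n, ?_⟩
    rw [map_add, pow_add, Module.End.mul_apply, Module.End.mul_apply, hn, map_zero, add_zero,
      ← Module.End.mul_apply, ← pow_add, add_comm, pow_add, Module.End.mul_apply, hm, map_zero]
  | mul S T _ _ hS hT =>
    obtain ⟨m, hm⟩ := hS
    obtain ⟨n, hn⟩ := hT
    exact ⟨m + n, commutatorMap_pow_mul_eq_zero _ _ m n rfl S T hm hn⟩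

/-- Induction on the nilpotency order: at `X b = 1` the commutator takes the value `T(g X^k) - T(g
X^(k+1))`. It inherits the vanishing for `k ≥ 1`, hence vanishes at `k = 0`, and `T g` has the same
value as `T (g X)`. -/
theorem aeval_eq_zero_of_commutatorMap_pow_eq_zero (b : Block) (x : Block → ℂ) (hx : x b = 1)
    (g : MvPolynomial Block ℂ) (N : ℕ) : ∀ T : Module.End ℂ (MvPolynomial Block ℂ),
      (commutatorMap (mulX b) ^ N) T = 0 →
      (∀ k, 1 ≤ k → aeval x (T (g * X b ^ k)) = 0) → aeval x (T g) = 0 := by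
  induction N with
  | zero =>
    intro T hT _
    have : T = 0 := by simpa using hT
    simp [this]
  | succ N ih =>
    intro T hT h
    have h1 := ih _ (by rwa [pow_succ, Module.End.mul_apply] at hT) fun k hk => by
      rw [aeval_commutatorMap b x hx, h k hk, h (k + 1) (by omega), sub_zero]
    have h2 := aeval_commutatorMap b x hx g T 0
    rw [pow_zero, mul_one, h1, h (0 + 1) le_rfl, sub_zero] at h2
    exact h2.symm

/-- If the values of a differential operator on `g X^k` are a quadratic function of `k` for
`k ≥ 1`, they are so for `k = 0`. -/
theorem aeval_diffOps_extrapolate {D : Module.End ℂ (MvPolynomial Block ℂ)} (hD : D ∈ diffOps)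
    (b : Block) (x : Block → ℂ) (hx : x b = 1) (g : MvPolynomial Block ℂ) (c₀ c₁ c₂ : ℂ)
    (h : ∀ k : ℕ, 1 ≤ k → aeval x (D (g * X b ^ k)) = c₀ + c₁ * k + c₂ * k ^ 2) :
    aeval x (D g) = c₀ := by
  obtain ⟨N, hN⟩ := exists_commutatorMap_pow_eq_zero b hD
  set δ := commutatorMap (mulX b) with hδ
  have h3 : ∀ k, aeval x (δ (δ (δ D)) (g * X b ^ k)) = aeval x (D (g * X b ^ k)) -
      3 * aeval x (D (g * X b ^ (k + 1))) + 3 * aeval x (D (g * X b ^ (k + 2))) -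
      aeval x (D (g * X b ^ (k + 3))) := by
    intro k
    simp only [hδ, aeval_commutatorMap b x hx]
    ring
  -- The triple commutator is a third difference, which annihilates quadratic functions of `k`.
  have h4 := aeval_eq_zero_of_commutatorMap_pow_eq_zero b x hx g N (δ (δ (δ D)))
    (by
      have : δ (δ (δ D)) = (δ ^ 3) D := by simp [pow_succ]
      rw [← hδ, this, ← Module.End.mul_apply, ← pow_add, add_comm, pow_add, Module.End.mul_apply,
        hN, map_zero])
    fun k hk => by
      rw [h3, h k hk, h (k + 1) (by omega), h (k + 2) (by omega), h (k + 3) (by omega)]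
      push_cast
      ring
  have h5 := h3 0
  rw [pow_zero, mul_one, h4, h _ (by omega), h _ (by omega), h _ (by omega)] at h5
  push_cast at h5
  linear_combination -h5

end Nilpotency

/-! ### Necessity of the dimension. -/

section Necessity

variable {d : ℕ}

/-- The `Z_i`-gradients are antisymmetric matrices applied to `P_i`, hence orthogonal to `P_i`. -/
theorem blockValue_shiftZ_self (i : Fin 3) (P Z : Triple d) (t : ℂ) :
    blockValue P (Z + t • slot i (P i)) = blockValue P Z := by
  funext b
  rw [blockValue_shiftZ]
  have hV : ∀ A B, dot (P i) (gradZV (P i) A B) = 0 := fun A B => by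
    simp only [gradZV, dot_sub_right, dot_smul_right]
    ring
  have hH : ∀ A α, dot (P i) (gradZH (P i) A α) = 0 := fun A α => by
    simp only [gradZH, dot_add_right, dot_smul_right]
    ring
  rcases b with j | j <;> rcases label_cases i j with rfl | rfl | rfl <;>
    simp [hV, hH, dot_zero_right]

theorem OnLocus.shiftZ {P Z : Triple d} (h : OnLocus P Z) (i : Fin 3) (t : ℂ) :
    OnLocus P (Z + t • slot i (P i)) := by
  intro j
  obtain ⟨h1, h2, h3⟩ := h j
  rcases label_cases i j with rfl | rfl | rfl
  · simp only [shift_self, dot_add_right, dot_add_left, dot_smul_left, dot_smul_right, h1, h2, h3,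
      dot_comm (Z j) (P j)]
    simp
  · simpa only [shift_add_one] using ⟨h1, h2, h3⟩
  · simpa only [shift_add_two] using ⟨h1, h2, h3⟩

/-- The shift of `Z_i` by `P_i` separates the obstruction from all functions of the blocks. Any
linear map `D` is allowed, because only the fact that its output is a polynomial in the blocks is
used. -/
theorem dimension_eq_of_reproduces (hd : 2 ≤ d) (i : Fin 3) {s : Fin 3 → ℕ} {Δ : Fin 3 → ℂ}
    (hs : 2 ≤ s i) {D : Module.End ℂ (MvPolynomial Block ℂ)} (hD : Reproduces d i s Δ D) :
    Δ i = (d : ℂ) - 1 + ((s i : ℂ) - 1) := by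
  obtain ⟨P, e, hPP, hPQ, hPe, hee⟩ := exists_null_frame hd
  have h01 : dot (P i) (P (i + 1)) = 1 := hPQ _ _ (label_add_one_ne i).symm
  have h02 : dot (P i) (P (i + 2)) = 1 := hPQ _ _ (label_add_two_ne i).symm
  have h12 : dot (P (i + 1)) (P (i + 2)) = 1 := hPQ _ _ (label_add_two_ne_add_one i).symm
  -- The difference `P_{j+1} - P_{j+2}` has square `-2`, which the vector `e` of square `2`
  -- compensates; every `V` takes the value `-2`.
  set Z : Triple d := fun j => P (j + 1) - P (j + 2) + e with hZ
  have hPP1 : ∀ j, dot (P j) (P (j + 1)) = 1 := fun j => hPQ _ _ (label_add_one_ne j).symm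
  have hPP2 : ∀ j, dot (P j) (P (j + 2)) = 1 := fun j => hPQ _ _ (label_add_two_ne j).symm
  have hPP3 : ∀ j, dot (P (j + 1)) (P (j + 2)) = 1 := fun j =>
    hPQ _ _ (label_add_two_ne_add_one j).symm
  have hloc : OnLocus P Z := by
    intro j
    refine ⟨hPP j, ?_, ?_⟩
    · simp only [hZ, dot_add_right, dot_sub_right, hPP1, hPP2, hPe]
      ring
    · simp only [hZ, dot_add_right, dot_sub_right, dot_add_left, dot_sub_left, hPP, hPP3, hPe, hee,
        dot_comm (P (j + 2)) (P (j + 1)), dot_comm e]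
      ring
  have hV : ∀ j, blockValue P Z (Sum.inr j) = -2 := by
    intro j
    simp only [blockValue_inr_self, structV, hZ, dot_add_left, dot_sub_left, hPP, hPP3, hPP1, hPP2,
      dot_comm (P (j + 2)) (P (j + 1)), dot_comm e, hPe]
    norm_num
  have hU : ∀ j, dot (P j) (P (j + 1)) ∈ Complex.slitPlane := fun j => by
    rw [hPP1]
    exact Complex.one_mem_slitPlane
  have hcond : ∀ j, s j + (0 : Fin 3 → ℕ) j + (0 : Fin 3 → ℕ) (j + 2) = s j := by simp
  have hspin : spinOp i (blockMonomial 0 s) = (s i : ℂ) • blockMonomial 0 s := by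
    rw [spinOp_blockMonomial, hcond]
  have key : ∀ t : ℂ, _ := fun t =>
    (divergence_evalOverPrefactor s Δ i isLogBranch_log (hloc.shiftZ i t) hU hspin
      (A := algebraMap ℂ _ (tau s Δ i)) (B := algebraMap ℂ _ (tau s Δ (i + 2)))
      (C := algebraMap ℂ _ ((d : ℂ) / 2 - 2 + s i)) (Module.algebraMap_end_apply _ _ _ _ _)
      (Module.algebraMap_end_apply _ _ _ _ _) (Module.algebraMap_end_apply _ _ _ _ _)).symm.trans
    (hD 0 s hcond _ _ isLogBranch_log P _ (hloc.shiftZ i t) hU)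
  have heval : ∀ (t : ℂ) q, evalOverPrefactor Complex.log s Δ q P (Z + t • slot i (P i)) =
      evalOverPrefactor Complex.log s Δ q P Z := fun t q => by
    simp only [evalOverPrefactor, blockValue_shiftZ_self]
  have k0 := key 0
  have k1 := key 1
  simp only [heval, shift_self, dot_add_left, dot_smul_left, h01, h02, h12] at k0 k1
  have hp : ∀ j, pderiv (Sum.inl j) (blockMonomial 0 s) = 0 := fun j => by
    have := X_mul_pderiv_blockMonomial 0 s (Sum.inl j)
    simpa [X_ne_zero] using this
  have hu := X_mul_pderiv_blockMonomial 0 s (Sum.inr i)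
  have huu : X (Sum.inr i) * pderiv (Sum.inr i) (pderiv (Sum.inr i) (blockMonomial 0 s)) =
      ((s i : ℂ) - 1) • pderiv (Sum.inr i) (blockMonomial 0 s) := by
    have := congrArg (pderiv (Sum.inr i)) hu
    rw [Derivation.leibniz, pderiv_X_self, smul_eq_mul, smul_eq_mul, mul_one, Derivation.map_smul,
      Sum.elim_inr] at this
    rw [sub_smul, one_smul, ← this, add_sub_cancel_right]
  have eu := congrArg (fun q => evalOverPrefactor Complex.log s Δ q P Z) hu
  have euu := congrArg (fun q => evalOverPrefactor Complex.log s Δ q P Z) huu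
  simp only [evalOverPrefactor_mul, evalOverPrefactor_smul, aeval_X, hV, Sum.elim_inr] at eu euu
  have eG := evalOverPrefactor_laplaceOp Complex.log s Δ P Z i (blockMonomial 0 s)
  simp only [hp, map_zero, evalOverPrefactor_zero, mul_zero, sub_zero, add_zero] at eG
  have hne : evalOverPrefactor Complex.log s Δ (blockMonomial 0 s) P Z ≠ 0 := by
    rw [evalOverPrefactor]
    refine div_ne_zero ?_ (Finset.prod_ne_zero_iff.2 fun j _ => Complex.exp_ne_zero _)
    simp [blockMonomial, map_prod, hV, Finset.prod_ne_zero_iff]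
  have hn0 : (s i : ℂ) ≠ 0 := by
    have : s i ≠ 0 := by omega
    exact_mod_cast this
  have hn1 : (s i : ℂ) - 1 ≠ 0 := by
    have : s i ≠ 1 := by omega
    rw [sub_ne_zero]
    exact_mod_cast this
  -- On a monomial in the `V`s alone the Laplacian reduces to `∂²/∂V_i²`. With `V_i² = 4`, four
  -- times its value is `s_i (s_i - 1)` times the monomial, non-zero since `s_i ≥ 2`.
  have hGne : evalOverPrefactor Complex.log s Δ (laplaceOp i (blockMonomial 0 s)) P Z ≠ 0 := by
    have h4 : 4 * evalOverPrefactor Complex.log s Δ (laplaceOp i (blockMonomial 0 s)) P Z =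
        ((s i : ℂ) - 1) * s i * evalOverPrefactor Complex.log s Δ (blockMonomial 0 s) P Z := by
      rw [eG]
      linear_combination -2 * euu + ((s i : ℂ) - 1) * eu
    intro h0
    rw [h0, mul_zero] at h4
    exact mul_ne_zero (mul_ne_zero hn1 hn0) hne h4.symm
  have hfin : ((d : ℂ) / 2 - 1 + s i - (tau s Δ i + tau s Δ (i + 2)) / 2) *
      evalOverPrefactor Complex.log s Δ (laplaceOp i (blockMonomial 0 s)) P Z = 0 := by
    -- All scalar products of distinct `P`s are `1`, so the unit shift raises `w_A + w_B` by exactly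
    -- `2`.
    linear_combination (k1 - k0) / 2
  have h5 := (mul_eq_zero.1 hfin).resolve_right hGne
  rw [tau_add_two, tau] at h5
  linear_combination -2 * h5

theorem blockMonomial_single (i : Fin 3) (k : ℕ) :
    blockMonomial (Pi.single i 1) (Pi.single i k) = X (Sum.inl i) * X (Sum.inr i) ^ k := by
  rw [blockMonomial, prod_labels i]
  simp

/-- The value `V_i = 1` makes powers of `V_i` invisible, as the extrapolation requires; the
vanishing of the `H`s and of `V_{i+2}` removes most terms of the operator. -/
theorem exists_mixed_configuration (hd : 2 ≤ d) (i : Fin 3) :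
    ∃ P Z : Triple d, OnLocus P Z ∧ (∀ j, dot (P j) (P (j + 1)) = 1) ∧
      blockValue P Z (Sum.inr i) = 1 ∧ blockValue P Z (Sum.inr (i + 1)) = -2 ∧
      blockValue P Z (Sum.inr (i + 2)) = 0 ∧ ∀ j, blockValue P Z (Sum.inl j) = 0 := by
  obtain ⟨P, e, hPP, hPQ, hPe, hee⟩ := exists_null_frame hd
  have h01 : dot (P i) (P (i + 1)) = 1 := hPQ _ _ (label_add_one_ne i).symm
  have h02 : dot (P i) (P (i + 2)) = 1 := hPQ _ _ (label_add_two_ne i).symm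
  have h12 : dot (P (i + 1)) (P (i + 2)) = 1 := hPQ _ _ (label_add_two_ne_add_one i).symm
  -- The opposite signs of `e` in `Z_i` and `Z_{i+1}` make `H_{i,i+1}` vanish, and the scale `-1/2`
  -- turns `V_i = -2` into `1`.
  set Z : Triple d := fun j => if j = i then (-1 / 2 : ℂ) • (P (i + 1) - P (i + 2) + e)
    else if j = i + 1 then P (i + 2) - P i - e else 0 with hZ
  have hZ0 : Z i = (-1 / 2 : ℂ) • (P (i + 1) - P (i + 2) + e) := by simp [hZ]
  have hZ1 : Z (i + 1) = P (i + 2) - P i - e := by simp [hZ]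
  have hZ2 : Z (i + 2) = 0 := by simp [hZ]
  refine ⟨P, Z, fun j => ⟨hPP j, ?_⟩, fun j => hPQ _ _ (label_add_one_ne j).symm, ?_, ?_, ?_,
    fun j => ?_⟩
  · rcases label_cases i j with rfl | rfl | rfl
    · simp only [hZ0, dot_add_left, dot_add_right, dot_sub_left, dot_sub_right, dot_smul_left,
        dot_smul_right, hPP, h01, h02, h12, hPe, hee, dot_comm e,
        dot_comm (P (j + 2)) (P (j + 1))]
      norm_num
    · simp only [hZ1, dot_sub_left, dot_sub_right, hPP, h01, h02, h12, hPe, hee, dot_comm e,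
        dot_comm (P (i + 2)) (P i), dot_comm (P (i + 1)) (P i)]
      norm_num
    · simp only [hZ2, dot_zero_right, and_self]
  · simp only [blockValue_inr_self, structV, hZ0, dot_add_left, dot_sub_left, dot_smul_left, hPP,
      h01, h02, h12, hPe, dot_comm e, dot_comm (P (i + 2)) (P (i + 1))]
    norm_num
  · simp only [blockValue_inr_add_one, structV, hZ1, dot_sub_left, hPP, h01, h02, h12, hPe,
      dot_comm e, dot_comm (P (i + 2)) (P i), dot_comm (P (i + 1)) (P i)]
    norm_num
  · simp only [blockValue_inr_add_two, structV, hZ2, dot_zero_left]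
    norm_num
  · rcases label_cases i j with rfl | rfl | rfl
    · simp only [blockValue_inl_self, structH, hZ0, hZ1, dot_add_left, dot_sub_left, dot_smul_left,
        dot_sub_right, hPP, h01, h02, h12, hPe, hee, dot_comm e,
        dot_comm (P (j + 2)) (P (j + 1)), dot_comm (P (j + 2)) (P j), dot_comm (P (j + 1)) (P j)]
      norm_num
    · simp only [blockValue_inl_add_one, structH, hZ2, dot_zero_right]
      norm_num
    · simp only [blockValue_inl_add_two, structH, hZ2, dot_zero_right]
      norm_num

/-- The value at a mixed configuration of `∂_{P_i}·D_{Z_i}` on the monomials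
`H_{i,i+1} V_{i,(i+1)(i+2)}^k`. -/
theorem aeval_of_reproduces_mixed (i : Fin 3) {s : Fin 3 → ℕ} {Δ : Fin 3 → ℂ} {k : ℕ}
    (hs : s = Pi.single i (k + 1) + Pi.single (i + 1) 1)
    {D : Module.End ℂ (MvPolynomial Block ℂ)} (hD : Reproduces d i s Δ D) {P Z : Triple d}
    (hloc : OnLocus P Z) (hP : ∀ j, dot (P j) (P (j + 1)) = 1)
    (hu : blockValue P Z (Sum.inr i) = 1) (hv : blockValue P Z (Sum.inr (i + 1)) = -2)
    (hw : blockValue P Z (Sum.inr (i + 2)) = 0) (hH : ∀ j, blockValue P Z (Sum.inl j) = 0)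
    (hΔ : k = 0 ∨ Δ i = (d : ℂ) - 1 + k) :
    aeval (blockValue P Z) (D (X (Sum.inl i) * X (Sum.inr i) ^ k)) =
      ((d : ℂ) / 2 - 1 + k) * (4 * k - 4 * tau s Δ (i + 2)) +
        2 * k * (tau s Δ (i + 2) - tau s Δ i) + 4 * k := by
  have hU : ∀ j, dot (P j) (P (j + 1)) ∈ Complex.slitPlane := fun j => by
    rw [hP]
    exact Complex.one_mem_slitPlane
  have hs0 : s i = k + 1 := by simp [hs]
  have hs1 : s (i + 1) = 1 := by simp [hs]
  have hs2 : s (i + 2) = 0 := by simp [hs]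
  have hcond : ∀ j, (Pi.single i k : Fin 3 → ℕ) j + (Pi.single i 1 : Fin 3 → ℕ) j +
      (Pi.single i 1 : Fin 3 → ℕ) (j + 2) = s j := by
    intro j
    rcases label_cases i j with rfl | rfl | rfl
    · simp [hs0]
    · simp [hs1, label_add_one_add_two]
    · simp [hs2, label_add_two_add_two]
  have hspin : spinOp i (blockMonomial (Pi.single i 1) (Pi.single i k)) =
      (s i : ℂ) • blockMonomial (Pi.single i 1) (Pi.single i k) := by
    rw [spinOp_blockMonomial, hcond]
  have key := (hD _ _ hcond _ _ isLogBranch_log P Z hloc hU).symm.trans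
    (divergence_evalOverPrefactor s Δ i isLogBranch_log hloc hU hspin
      (A := algebraMap ℂ _ (tau s Δ i)) (B := algebraMap ℂ _ (tau s Δ (i + 2)))
      (C := algebraMap ℂ _ ((d : ℂ) / 2 - 2 + s i)) (Module.algebraMap_end_apply _ _ _ _ _)
      (Module.algebraMap_end_apply _ _ _ _ _) (Module.algebraMap_end_apply _ _ _ _ _))
  rw [evalOverPrefactor_divergenceOp s Δ i _ P Z (Module.algebraMap_end_apply _ _ _ _ _)
      (Module.algebraMap_end_apply _ _ _ _ _) (Module.algebraMap_end_apply _ _ _ _ _)] at key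
  have heval : ∀ q, evalOverPrefactor Complex.log s Δ q P Z = aeval (blockValue P Z) q := by
    intro q
    simp [evalOverPrefactor, hP]
  have hpu : pderiv (Sum.inr i) (X (Sum.inl i) * X (Sum.inr i) ^ k : MvPolynomial Block ℂ) =
      (k : ℂ) • (X (Sum.inl i) * X (Sum.inr i) ^ (k - 1)) := by
    rw [Derivation.leibniz, Derivation.leibniz_pow, pderiv_X_self, pderiv_X_of_ne (by simp)]
    simp [smul_eq_C_mul]
    ring
  have hpp : pderiv (Sum.inl i) (X (Sum.inl i) * X (Sum.inr i) ^ k : MvPolynomial Block ℂ) =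
      X (Sum.inr i) ^ k := by
    rw [Derivation.leibniz, Derivation.leibniz_pow, pderiv_X_self, pderiv_X_of_ne (by simp)]
    simp
  have hpr : pderiv (Sum.inl (i + 2))
      (X (Sum.inl i) * X (Sum.inr i) ^ k : MvPolynomial Block ℂ) = 0 := by
    rw [Derivation.leibniz, Derivation.leibniz_pow, pderiv_X_of_ne (by simp),
      pderiv_X_of_ne (by simp)]
    simp
  have hpup : pderiv (Sum.inr i) (X (Sum.inr i) ^ k : MvPolynomial Block ℂ) =
      (k : ℂ) • X (Sum.inr i) ^ (k - 1) := by
    rw [Derivation.leibniz_pow, pderiv_X_self]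
    simp [smul_eq_C_mul]
  -- The factor `H_{i,i+1}` vanishes at the configuration, so the cofactor `q` need not be computed.
  have hpuu : ∃ q : MvPolynomial Block ℂ, pderiv (Sum.inr i)
      (X (Sum.inl i) * X (Sum.inr i) ^ (k - 1) : MvPolynomial Block ℂ) = X (Sum.inl i) * q ∧
      pderiv (Sum.inr (i + 1)) q = 0 := by
    refine ⟨pderiv (Sum.inr i) (X (Sum.inr i) ^ (k - 1)), ?_, ?_⟩
    · rw [Derivation.leibniz, pderiv_X_of_ne (by simp)]
      simp
    · rw [pderiv_comm, Derivation.leibniz_pow, pderiv_X_of_ne (by simp)]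
      simp
  obtain ⟨q₂, hq₂, hq₂'⟩ := hpuu
  have hlap : laplaceOp i (X (Sum.inl i) * X (Sum.inr i) ^ k) =
      (k : ℂ) • (X (Sum.inl i) * q₂) -
        (2 * k : ℂ) • (X (Sum.inr (i + 1)) * X (Sum.inr i) ^ (k - 1)) := by
    simp only [laplaceOp, LinearMap.add_apply, LinearMap.sub_apply, LinearMap.smul_apply,
      Module.End.mul_apply, mulX_apply, der_apply, hpu, hpp, hpr, hpup, map_zero,
      smul_zero, sub_zero, add_zero, Derivation.map_smul, hq₂, mul_smul_comm, smul_smul]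
  have hpow : ∀ (j : Fin 3) (m : ℕ), j ≠ i →
      pderiv (Sum.inr j) (X (Sum.inr i) ^ m : MvPolynomial Block ℂ) = 0 := fun j m hj => by
    rw [Derivation.leibniz_pow, pderiv_X_of_ne (by simpa using hj.symm)]
    simp
  have hinl : ∀ j : Fin 3, pderiv (Sum.inr j) (X (Sum.inl i) : MvPolynomial Block ℂ) = 0 :=
    fun j => pderiv_X_of_ne (by simp)
  have hvlap : pderiv (Sum.inr (i + 1)) (laplaceOp i (X (Sum.inl i) * X (Sum.inr i) ^ k)) =
      -((2 * k : ℂ) • X (Sum.inr i) ^ (k - 1)) := by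
    rw [hlap, map_sub, Derivation.map_smul, Derivation.map_smul, Derivation.leibniz,
      Derivation.leibniz, hq₂', hinl, hpow _ _ (label_add_one_ne i), pderiv_X_self]
    simp
  have hmix : ∀ j : Fin 3, j ≠ i → pderiv (Sum.inr j)
      (X (Sum.inl i) * X (Sum.inr i) ^ (k - 1) : MvPolynomial Block ℂ) = 0 := fun j hj => by
    rw [Derivation.leibniz, hinl, hpow _ _ hj, smul_zero, smul_zero, add_zero]
  rw [blockMonomial_single, hvlap] at key
  simp only [heval, hlap, hpu, hpp, hpr, map_zero, map_smul, map_sub, map_neg, map_mul, map_pow,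
    aeval_X, hu, hv, hw, hH, Derivation.map_smul, hpup, hmix _ (label_add_one_ne i),
    hmix _ (label_add_two_ne i), hpow _ _ (label_add_one_ne i), hpow _ _ (label_add_two_ne i),
    smul_eq_mul, one_pow, hs0] at key
  rw [key]
  -- The obstruction vanishes in both cases: for `k = 0` the Laplacian is zero, otherwise its
  -- coefficient is.
  rcases hΔ with rfl | hΔ
  · push_cast
    ring
  · rw [tau_add_two, tau, hs0, hs1, hs2, hΔ]
    push_cast
    ring

/-- At `s_i = 1` the value at the mixed configuration depends on `δ 1` through `τ_{i+2}`.
Extrapolation from higher spins prescribes it independently, and comparing the two fixes `δ 1`. -/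
theorem dimension_one_eq_of_reproduces (hd : 3 ≤ d) (i : Fin 3) (Δ : Fin 3 → ℂ) (δ : ℕ → ℂ)
    {D : Module.End ℂ (MvPolynomial Block ℂ)} (hDmem : D ∈ diffOps)
    (hD : ∀ s : Fin 3 → ℕ, 1 ≤ s i → Reproduces d i s (Function.update Δ i (δ (s i))) D)
    (hδ : ∀ n : ℕ, 2 ≤ n → δ n = (d : ℂ) - 1 + ((n : ℂ) - 1)) : δ 1 = (d : ℂ) - 1 := by
  obtain ⟨P, Z, hloc, hP, hu, hv, hw, hH⟩ := exists_mixed_configuration (by omega : 2 ≤ d) i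
  have hval := fun k : ℕ => aeval_of_reproduces_mixed i (k := k) rfl
    (hD (Pi.single i (k + 1) + Pi.single (i + 1) 1) (by simp)) hloc hP hu hv hw hH
  -- For `k ≥ 1` the dimension `d - 1 + k` makes `k - τ_{i+2}` independent of `k`, so the values are
  -- affine in `k` and the quadratic coefficient is `0`.
  have h1 := aeval_diffOps_extrapolate hDmem (Sum.inr i) _ hu (X (Sum.inl i))
    (-2 * ((d : ℂ) / 2 - 1) * ((d : ℂ) - 1 + Δ (i + 2) - Δ (i + 1)))
    (2 - 2 * (Δ (i + 1) - Δ (i + 2)) - 2 * ((d : ℂ) - 1 + Δ (i + 2) - Δ (i + 1))) 0 fun k hk => by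
      rw [hval k (Or.inr (by simp [hδ (k + 1) (by omega)]))]
      rw [tau_add_two, tau]
      simp [hδ (k + 1) (by omega)]
      ring
  have h2 := hval 0 (Or.inl rfl)
  rw [pow_zero, mul_one, h1, tau_add_two] at h2
  simp at h2
  -- Both values carry the factor `d/2 - 1`; this is where `d = 2` has to be excluded.
  have hc : (d : ℂ) / 2 - 1 ≠ 0 := by
    have : (d : ℂ) ≠ 2 := by
      have : d ≠ 2 := by omega
      exact_mod_cast this
    intro h
    exact this (by linear_combination 2 * h)
  have h3 := mul_left_cancel₀ hc (b := 2 * ((d : ℂ) - 1 + Δ (i + 2) - Δ (i + 1)))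
    (c := 4 * ((Δ (i + 2) + δ 1 - Δ (i + 1)) / 2)) (by linear_combination h2)
  linear_combination -h3 / 2

end Necessity

end

end ThreePoint

theorem theorem8p3 (d : ℕ) (hd : 3 ≤ d) (i : Fin 3) :
    (∀ (s : Fin 3 → ℕ) (Δ : Fin 3 → ℂ), 2 ≤ s i →
      ((∃ D ∈ ThreePoint.diffOps, ThreePoint.Reproduces d i s Δ D) ↔
        Δ i = (d : ℂ) - 1 + ((s i : ℂ) - 1))) ∧
    (∀ (Δ : Fin 3 → ℂ) (δ : ℕ → ℂ),
      ((∃ D ∈ ThreePoint.diffOps, ∀ s : Fin 3 → ℕ, 1 ≤ s i →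
          ThreePoint.Reproduces d i s (Function.update Δ i (δ (s i))) D) ↔
        ∀ n : ℕ, 1 ≤ n → δ n = (d : ℂ) - 1 + ((n : ℂ) - 1))) := by
  refine ⟨fun s Δ hs => ⟨fun ⟨D, _, hD⟩ => ?_, fun hΔ => ?_⟩,
    fun Δ δ => ⟨fun ⟨D, hDmem, hD⟩ => ?_, fun hδ => ?_⟩⟩
  · exact ThreePoint.dimension_eq_of_reproduces (by omega) i hs hD
  · obtain ⟨D, hDmem, hD⟩ := ThreePoint.exists_reproduces d i Δ
    exact ⟨D, hDmem, hD s Δ hΔ fun _ _ => rfl⟩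
  · have h2 : ∀ n : ℕ, 2 ≤ n → δ n = (d : ℂ) - 1 + ((n : ℂ) - 1) := by
      intro n hn
      -- Any spins with `s_i = n` would do; equal spins are the simplest choice.
      have := ThreePoint.dimension_eq_of_reproduces (by omega) i (s := fun _ => n) hn
        (hD (fun _ => n) (by omega))
      simpa using this
    intro n hn
    obtain rfl | hn := hn.eq_or_lt
    · rw [ThreePoint.dimension_one_eq_of_reproduces hd i Δ δ hDmem hD h2]
      simp
    · exact h2 n hn
  · obtain ⟨D, hDmem, hD⟩ := ThreePoint.exists_reproduces d i Δ
    refine ⟨D, hDmem, fun s hs => hD s _ ?_ fun j hj => Function.update_of_ne hj _ _⟩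
    rw [Function.update_self, hδ _ hs]
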